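/- Let $L>0$, let $\mathbb T=\mathbb R/L\mathbb Z$, and let $X=C_{\mathrm{even}}(\mathbb T)$ be the Banach space of even continuous real functions on $\mathbb T$ with the sup norm. Let $p$ be a real analytic function on $(0,\infty)$ such that, for all $\xi>0$, $p'(\xi)>0$ and $3p'(\xi)+\xi p''(\xi)>0$, and such that $\lim_{\xi\to0^+}\xi^3p'(\xi)=0$ and $$\lim_{\xi\to\infty}\frac{\xi^4p'(\xi)-2\xi(p(\xi)-p(1))-2\xi\log\xi}{\max_{\eta\in[1,\xi]}p'(\eta)+1}=\infty .$$ For positive $f\in X$ write $\mathcal H^{-1}(f)$ for the unique $\phi\in C^2(\mathbb T)$ with $-\phi''+\mathrm e^{\phi}=f$, and set $$\mathcal F(c,f)=\frac{c^2}{2}\Big(\frac1{f^2}-1\Big)+p(f)-p(1)+\mathcal H^{-1}(f),\qquad c_0=\sqrt{p'(1)+\frac1{1+(2\pi/L)^2}} .$$ Then there are $\varepsilon>0$ and analytic functions $(\Psi,\Phi):(-\varepsilon,\varepsilon)\to\mathbb R\times X$ such that: 1. $(\Psi(0),\Phi(0))=(c_0,1)$, and $\mathcal F(\Psi(s),\Phi(s))=0$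 for all $s\in(-\varepsilon,\varepsilon)$; 2. there is an open set $U_0\subset\mathbb R\times X$ containing $(c_0,1)$, such that for every $(c,f)\in U_0$ the function $f$ is positive and $\mathcal H^{-1}(f)$ is well defined, with $$\{(c,f)\in U_0:\ \mathcal F(c,f)=0,\ f\not\equiv1\}=\{(\Psi(s),\Phi(s)):\ 0<|s|<\varepsilon\};$$ in particular $\Phi(s)\not\equiv 1$ for $0<|s|<\varepsilon$; 3. for $s\in(-\varepsilon,\varepsilon)$, with constants in the $\mathcal O$ terms independent of $s$, $$\Phi(s)=1+s\cos\Big(\frac{2\pi}{L}\,\cdot\Big)+\mathcal O(s^2)\ \text{ in }X,\qquad \Psi(s)=c_0+\Psi'(0)s+\tfrac12\Psi''(0)s^2+\mathcal O(s^3).$$ -/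

import Mathlib

open Set Filter Topology

noncomputable section

namespace EulerPoisson

/-- The weight `W` of the admissibility conditions on the profile `p`. The function `p'` is
continuous for the profiles considered, so the supremum over the compact `[1, ξ]` is a maximum. -/
def pressureWeight (p : ℝ → ℝ) (ξ : ℝ) : ℝ :=
  (ξ ^ 4 * deriv p ξ - 2 * ξ * (p ξ - p 1) - 2 * ξ * Real.log ξ) /
    (sSup (deriv p '' Icc 1 ξ) + 1)

/-- The standing assumptions on the pressure profile `p` on `(0, ∞)`. -/
structure IsAdmissibleProfile (p : ℝ → ℝ) : Prop where
  analytic : AnalyticOnNhd ℝ p (Ioi 0)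
  deriv_pos : ∀ ξ : ℝ, 0 < ξ → 0 < deriv p ξ
  convexity : ∀ ξ : ℝ, 0 < ξ → 0 < 3 * deriv p ξ + ξ * iteratedDeriv 2 p ξ
  tendsto_zero : Tendsto (fun ξ : ℝ => ξ ^ 3 * deriv p ξ) (𝓝[>] 0) (𝓝 0)
  tendsto_weight : Tendsto (pressureWeight p) atTop atTop

/-- The even continuous real functions on the torus `ℝ / Lℤ`. For `0 < L` it carries the norm
induced by the supremum norm. -/
def CEven (L : ℝ) : Submodule ℝ C(AddCircle L, ℝ) where
  carrier := {f | ∀ x : AddCircle L, f (-x) = f x}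
  add_mem' := by
    intro f g hf hg x
    simp [hf x, hg x]
  zero_mem' := by
    intro x
    simp
  smul_mem' := by
    intro a f hf x
    simp [hf x]

/-- The constant function `1`. -/
def evenOne (L : ℝ) : CEven L := ⟨1, fun _ => rfl⟩

theorem cos_periodic (L : ℝ) : Function.Periodic (fun x : ℝ => Real.cos (2 * Real.pi / L * x)) L := by
  intro x
  rcases eq_or_ne L 0 with rfl | hL
  · simp
  · have h : 2 * Real.pi / L * (x + L) = 2 * Real.pi / L * x + 2 * Real.pi := by
      field_simp
    change Real.cos (2 * Real.pi / L * (x + L)) = Real.cos (2 * Real.pi / L * x)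
    rw [h, Real.cos_add_two_pi]

/-- The function `x ↦ cos (2πx / L)` on the torus. -/
def evenCos (L : ℝ) : CEven L :=
  ⟨⟨(cos_periodic L).lift, by
      refine continuous_quot_lift _ ?_
      fun_prop⟩, by
    intro x
    induction x using QuotientAddGroup.induction_on with
    | H x =>
      change Real.cos (2 * Real.pi / L * (-x)) = Real.cos (2 * Real.pi / L * x)
      rw [mul_neg, Real.cos_neg]⟩

/-- `φ` is of class `C²` on the torus. -/
def IsC2 {L : ℝ} (φ : C(AddCircle L, ℝ)) : Prop :=
  ContDiff ℝ 2 (fun x : ℝ => φ (x : AddCircle L))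

/-- The operator `𝓗(φ) = -φ'' + exp φ`, with values read as functions on the line. -/
def opH {L : ℝ} (φ : C(AddCircle L, ℝ)) : ℝ → ℝ := fun x =>
  -iteratedDeriv 2 (fun y : ℝ => φ (y : AddCircle L)) x + Real.exp (φ (x : AddCircle L))

/-- `φ` is a `C²` solution of `𝓗(φ) = f` on the torus. -/
def SolvesH {L : ℝ} (f φ : C(AddCircle L, ℝ)) : Prop :=
  IsC2 φ ∧ ∀ x : ℝ, opH φ x = f (x : AddCircle L)

/-- The inverse `𝓗⁻¹(f)`: the `C²` solution `φ` of `𝓗(φ) = f`, meaningful for those `f` for which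
there is exactly one. -/
def invH {L : ℝ} (f : C(AddCircle L, ℝ)) : C(AddCircle L, ℝ) :=
  Classical.epsilon (SolvesH f)

/-- The local part `𝓖_c(ξ) = (c² / 2) (1 / ξ² - 1) + p(ξ) - p(1)`. -/
def localG (p : ℝ → ℝ) (c ξ : ℝ) : ℝ :=
  c ^ 2 / 2 * (1 / ξ ^ 2 - 1) + p ξ - p 1

/-- The functional `𝓕(c, f) = 𝓖_c(f) + 𝓗⁻¹(f)`. -/
def functionalF {L : ℝ} (p : ℝ → ℝ) (c : ℝ) (f : CEven L) : AddCircle L → ℝ := fun x =>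
  localG p c ((f : C(AddCircle L, ℝ)) x) + invH (f : C(AddCircle L, ℝ)) x

/-- The domain of `𝓕`: pairs `(c, f)` with `f` positive and `𝓗⁻¹(f)` well defined. -/
def domainF (L : ℝ) : Set (ℝ × CEven L) :=
  {q | (∀ x : AddCircle L, 0 < (q.2 : C(AddCircle L, ℝ)) x) ∧
    ∃! φ : C(AddCircle L, ℝ), SolvesH (q.2 : C(AddCircle L, ℝ)) φ}

/-- The bifurcation speed `c₀ = √(p'(1) + 1 / (1 + (2π/L)²))`. -/
def bifurcationSpeed (p : ℝ → ℝ) (L : ℝ) : ℝ :=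
  Real.sqrt (deriv p 1 + 1 / (1 + (2 * Real.pi / L) ^ 2))

end EulerPoisson

end

/-! The theorem is analytic bifurcation from a simple eigenvalue, arranged so that `𝓗⁻¹` is never
differentiated. Write f = 1 + h and 𝓖_c(1 + h) = h Q(c, h) with Q analytic. Then 𝓕(c, f) = 0 means
that φ = -h Q solves -φ'' + e^φ = 1 + h. With K = (1 - ∂²)⁻¹ and e₁(y) = (e^y - 1)/y this reads φ =
K(h - φ(e₁(φ) - 1)). Each term carries a factor h, so the equation is A(c, h) h = 0 for an analytic
family of operators A (`exists_operator_family`).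

At h = 0 the operator is A(c, 0) = (c² - p'(1)) - K. On even functions cos(2πx/L) is a simple
eigenfunction of K with eigenvalue 1/(1 + (2π/L)²), which equals c₀² - p'(1). Hence A(c₀, 0) has
kernel spanned by the cosine and range equal to the kernel of the cosine coefficient ℓ. The
c-derivative of A(c, 0) on the cosine is 2c₀ times the cosine, and c₀ > 0 gives transversality.

The abstract result `exists_bifurcation_curve` then applies. Putting h = s v with ℓ v = 1 divides
out the trivial branch, and the inverse function theorem for (s, c, v) ↦ (s, ℓ v, A(c, s v) v) gives
the curve. A lower bound for A(c₀, 0) on ker ℓ forces every nearby nontrivial solution to have v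
close to e, hence to lie on that curve. -/

noncomputable section

namespace EulerPoisson

/-! ### Abstract analytic bifurcation from a simple eigenvalue -/

section Bifurcation

variable {E : Type*} [NormedAddCommGroup E] [NormedSpace ℝ E]

/-- The desingularised bifurcation map `(s, c, v) ↦ (s, ℓ v, A (c, s v) v)`. -/
def desingularized (A : ℝ × E → E →L[ℝ] E) (l : E →L[ℝ] ℝ) (x : ℝ × ℝ × E) : ℝ × ℝ × E :=
  (x.1, l x.2.2, A (x.2.1, x.1 • x.2.2) x.2.2)

theorem analyticAt_desingularized {A : ℝ × E → E →L[ℝ] E} {c₀ : ℝ}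
    (hA : AnalyticAt ℝ A (c₀, 0)) (l : E →L[ℝ] ℝ) (e : E) :
    AnalyticAt ℝ (desingularized A l) (0, c₀, e) := by
  have h3 : AnalyticAt ℝ (fun x : ℝ × ℝ × E => x.2.2) (0, c₀, e) :=
    analyticAt_snd.comp analyticAt_snd
  have h2 : AnalyticAt ℝ (fun x : ℝ × ℝ × E => x.2.1) (0, c₀, e) :=
    AnalyticAt.fun_comp analyticAt_fst analyticAt_snd
  have hA' : AnalyticAt ℝ (fun x : ℝ × ℝ × E => A (x.2.1, x.1 • x.2.2)) (0, c₀, e) := by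
    refine AnalyticAt.fun_comp (g := A) (f := fun x : ℝ × ℝ × E => (x.2.1, x.1 • x.2.2)) ?_ ?_
    · simpa using hA
    · exact h2.prod (analyticAt_fst.smul h3)
  refine analyticAt_fst.prod (((l.analyticAt _).fun_comp h3).prod ?_)
  exact AnalyticAt.fun_comp (g := fun y : (E →L[ℝ] E) × E => y.1 y.2)
    (ContinuousLinearMap.analyticAt_bilinear (ContinuousLinearMap.id ℝ (E →L[ℝ] E)) _)
    (hA'.prod h3)

/-- The derivative of the desingularised map. -/
def desingularizedDeriv (A₀ : E →L[ℝ] E) (A' : ℝ × E →L[ℝ] E →L[ℝ] E) (l : E →L[ℝ] ℝ) (e : E) :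
    ℝ × ℝ × E →L[ℝ] ℝ × ℝ × E :=
  (ContinuousLinearMap.fst ℝ ℝ (ℝ × E)).prod
    ((l.comp ((ContinuousLinearMap.snd ℝ ℝ E).comp (ContinuousLinearMap.snd ℝ ℝ (ℝ × E)))).prod
      (A₀.comp ((ContinuousLinearMap.snd ℝ ℝ E).comp (ContinuousLinearMap.snd ℝ ℝ (ℝ × E))) +
        (A'.comp (((ContinuousLinearMap.fst ℝ ℝ E).comp
          (ContinuousLinearMap.snd ℝ ℝ (ℝ × E))).prod
            ((ContinuousLinearMap.fst ℝ ℝ (ℝ × E)).smulRight e))).flip e))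

theorem desingularizedDeriv_apply (A₀ : E →L[ℝ] E) (A' : ℝ × E →L[ℝ] E →L[ℝ] E) (l : E →L[ℝ] ℝ)
    (e : E) (x : ℝ × ℝ × E) :
    desingularizedDeriv A₀ A' l e x =
      (x.1, l x.2.2, A₀ x.2.2 + A' (x.2.1, x.1 • e) e) := rfl

theorem hasFDerivAt_desingularized {A : ℝ × E → E →L[ℝ] E} {c₀ : ℝ}
    (hA : DifferentiableAt ℝ A (c₀, 0)) (l : E →L[ℝ] ℝ) (e : E) :
    HasFDerivAt (desingularized A l)
      (desingularizedDeriv (A (c₀, 0)) (fderiv ℝ A (c₀, 0)) l e) (0, c₀, e) := by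
  have h3 : HasFDerivAt (fun x : ℝ × ℝ × E => x.2.2)
      ((ContinuousLinearMap.snd ℝ ℝ E).comp (ContinuousLinearMap.snd ℝ ℝ (ℝ × E))) (0, c₀, e) :=
    hasFDerivAt_snd.comp _ hasFDerivAt_snd
  have h2 : HasFDerivAt (fun x : ℝ × ℝ × E => x.2.1)
      ((ContinuousLinearMap.fst ℝ ℝ E).comp (ContinuousLinearMap.snd ℝ ℝ (ℝ × E))) (0, c₀, e) :=
    hasFDerivAt_fst.comp (0, c₀, e) hasFDerivAt_snd
  have h1 : HasFDerivAt (fun x : ℝ × ℝ × E => x.1)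
      (ContinuousLinearMap.fst ℝ ℝ (ℝ × E)) (0, c₀, e) := hasFDerivAt_fst
  have hin := h2.prodMk (h1.smul h3)
  have hA' : HasFDerivAt A (fderiv ℝ A (c₀, 0)) ((c₀, (0 : ℝ) • e) : ℝ × E) := by
    simpa using hA.hasFDerivAt
  have h := h1.prodMk ((l.hasFDerivAt.comp _ h3).prodMk ((hA'.comp (0, c₀, e) hin).clm_apply h3))
  refine h.congr_fderiv ?_
  ext x <;> simp [desingularizedDeriv_apply]

/-- Applying `l` kills the range of `A₀` and isolates the speed variable, which transversality (`μ ≠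
0`) determines. What remains is `A₀` on the kernel of `l`, an isomorphism onto its range. -/
theorem bijective_desingularizedDeriv {A₀ : E →L[ℝ] E} {A' : ℝ × E →L[ℝ] E →L[ℝ] E}
    {l : E →L[ℝ] ℝ} {e : E} {μ : ℝ} (hle : l e = 1) (hμ : μ ≠ 0) (hA₀e : A₀ e = 0)
    (hA' : A' (1, 0) e = μ • e) (hl : ∀ w, l (A₀ w) = 0)
    (hker : ∀ w, A₀ w = 0 → ∃ a : ℝ, w = a • e) (hran : ∀ y, l y = 0 → ∃ w, A₀ w = y) :
    Function.Bijective (desingularizedDeriv A₀ A' l e) := by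
  have hA'' : ∀ γ : ℝ, A' (γ, 0) e = (γ * μ) • e := by
    intro γ
    have : ((γ, 0) : ℝ × E) = γ • (1, 0) := by simp
    rw [this, map_smul, smul_apply, hA', smul_smul]
  constructor
  · rw [injective_iff_map_eq_zero]
    rintro ⟨σ, γ, w⟩ h
    rw [desingularizedDeriv_apply] at h
    simp only [Prod.mk_eq_zero] at h
    obtain ⟨rfl, h2, h3⟩ := h
    rw [zero_smul, hA''] at h3
    have h4 := congrArg l h3
    rw [map_add, hl, map_smul, hle, map_zero, zero_add, smul_eq_mul, mul_one] at h4
    have hγ : γ = 0 := by simpa [hμ] using h4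
    subst hγ
    rw [zero_mul, zero_smul, add_zero] at h3
    obtain ⟨a, rfl⟩ := hker w h3
    rw [map_smul, hle, smul_eq_mul, mul_one] at h2
    simp [h2]
  · rintro ⟨σ, a, y⟩
    set y' := y - A' (0, σ • e) e with hy'
    have h0 : l (y' - l y' • e) = 0 := by simp [hle]
    obtain ⟨w, hw⟩ := hran _ h0
    -- The change of speed produces the `e`-component of `y'` and `w` the rest. A multiple of `e`,
    -- invisible to `A₀`, corrects the value of `l`.
    refine ⟨(σ, l y' / μ, w + (a - l w) • e), ?_⟩
    rw [desingularizedDeriv_apply]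
    have hsplit : ((l y' / μ, σ • e) : ℝ × E) = (l y' / μ, 0) + (0, σ • e) := by simp
    simp only [Prod.mk.injEq, true_and]
    refine ⟨by simp [hle], ?_⟩
    rw [hsplit, map_add A', add_apply, hA'', div_mul_cancel₀ _ hμ, map_add, hw,
      map_smul, hA₀e, smul_zero, hy']
    abel

set_option maxHeartbeats 800000 in
/-- Analytic bifurcation from a simple eigenvalue, for an equation of the form `A (c, h) h = 0`. -/
theorem exists_bifurcation_curve [CompleteSpace E] {A : ℝ × E → E →L[ℝ] E} {c₀ : ℝ}
    (hA : AnalyticAt ℝ A (c₀, 0)) {l : E →L[ℝ] ℝ} {e : E} {μ : ℝ}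
    (hle : l e = 1) (hμ : μ ≠ 0) (hA₀e : A (c₀, 0) e = 0)
    (hA' : HasDerivAt (fun c => A (c, 0) e) (μ • e) c₀) (hl : ∀ w, l (A (c₀, 0) w) = 0)
    (hker : ∀ w, A (c₀, 0) w = 0 → ∃ a : ℝ, w = a • e)
    (hran : ∀ y, l y = 0 → ∃ w, A (c₀, 0) w = y) {N : Set (ℝ × E)} (hN : N ∈ 𝓝 (c₀, (0 : E))) :
    ∃ (Ψ : ℝ → ℝ) (V : ℝ → E), AnalyticAt ℝ Ψ 0 ∧ AnalyticAt ℝ V 0 ∧ Ψ 0 = c₀ ∧ V 0 = e ∧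
      ∀ᶠ ε in 𝓝[>] (0 : ℝ),
        (∀ s, |s| < ε → A (Ψ s, s • V s) (s • V s) = 0) ∧
        ∃ U : Set (ℝ × E), IsOpen U ∧ (c₀, (0 : E)) ∈ U ∧ U ⊆ N ∧
          {q : ℝ × E | q ∈ U ∧ A q q.2 = 0 ∧ q.2 ≠ 0} =
            {q : ℝ × E | ∃ s : ℝ, 0 < |s| ∧ |s| < ε ∧ q = (Ψ s, s • V s)} := by
  set A₀ := A (c₀, 0) with hA₀
  set D := desingularizedDeriv A₀ (fderiv ℝ A (c₀, 0)) l e with hD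
  have hAd := hA.differentiableAt
  have hA'1 : fderiv ℝ A (c₀, 0) (1, 0) e = μ • e := by
    have h1 : HasFDerivAt A (fderiv ℝ A (c₀, 0)) (c₀, (0 : E)) := hAd.hasFDerivAt
    have h2 : HasDerivAt (fun c : ℝ => ((c, 0) : ℝ × E)) (1, 0) c₀ :=
      (hasDerivAt_id c₀).prodMk (hasDerivAt_const c₀ (0 : E))
    have h3 := (h1.comp_hasDerivAt c₀ h2).clm_apply (hasDerivAt_const c₀ e)
    rw [map_zero, add_zero] at h3
    exact h3.unique hA'
  have hbij : Function.Bijective D :=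
    bijective_desingularizedDeriv hle hμ hA₀e hA'1 hl hker hran
  let D' : (ℝ × ℝ × E) ≃L[ℝ] (ℝ × ℝ × E) := ContinuousLinearEquiv.ofBijective D
    (LinearMap.ker_eq_bot.2 hbij.1) (LinearMap.range_eq_top.2 hbij.2)
  have hD' : (D' : (ℝ × ℝ × E) →L[ℝ] (ℝ × ℝ × E)) = D := by ext x <;> rfl
  have hM := analyticAt_desingularized hA l e
  have hMd : fderiv ℝ (desingularized A l) (0, c₀, e) = D' := by
    rw [hD']; exact (hasFDerivAt_desingularized hAd l e).fderiv
  have hMs : HasStrictFDerivAt (desingularized A l)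
      (D' : (ℝ × ℝ × E) →L[ℝ] (ℝ × ℝ × E)) (0, c₀, e) := by
    rw [← hMd]; exact hM.hasStrictFDerivAt
  set Φ := hMs.toOpenPartialHomeomorph (desingularized A l) with hΦ
  have hcoe : ∀ x, Φ x = desingularized A l x := fun x => rfl
  have hsrc : (0, c₀, e) ∈ Φ.source := hMs.mem_toOpenPartialHomeomorph_source
  have hbase : desingularized A l (0, c₀, e) = (0, 1, 0) := by
    simp [desingularized, hle, ← hA₀, hA₀e]
  have hsymm : AnalyticAt ℝ Φ.symm (0, 1, 0) := by
    have := Φ.analyticAt_symm' hsrc (i := D') hM hMd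
    rwa [hcoe, hbase] at this
  have hsymm0 : Φ.symm (0, 1, 0) = (0, c₀, e) := by
    rw [← hbase, ← hcoe]; exact Φ.left_inv hsrc
  have hline : AnalyticAt ℝ (fun s : ℝ => ((s, 1, 0) : ℝ × ℝ × E)) 0 :=
    analyticAt_id.prod (analyticAt_const.prod analyticAt_const)
  have hcurve : AnalyticAt ℝ (fun s : ℝ => Φ.symm (s, 1, 0)) 0 :=
    AnalyticAt.fun_comp (f := fun s : ℝ => ((s, 1, 0) : ℝ × ℝ × E)) hsymm hline
  have hΨ : AnalyticAt ℝ (fun s : ℝ => (Φ.symm (s, 1, 0)).2.1) 0 :=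
    AnalyticAt.fun_comp analyticAt_fst (AnalyticAt.fun_comp analyticAt_snd hcurve)
  have hV : AnalyticAt ℝ (fun s : ℝ => (Φ.symm (s, 1, 0)).2.2) 0 :=
    AnalyticAt.fun_comp analyticAt_snd (AnalyticAt.fun_comp analyticAt_snd hcurve)
  have hΨ0 : (Φ.symm (0, 1, 0)).2.1 = c₀ := by rw [hsymm0]
  have hV0 : (Φ.symm (0, 1, 0)).2.2 = e := by rw [hsymm0]
  refine ⟨fun s => (Φ.symm (s, 1, 0)).2.1, fun s => (Φ.symm (s, 1, 0)).2.2, hΨ, hV, hΨ0, hV0, ?_⟩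
  -- the lower bound for `A₀` on the kernel of `l`
  obtain ⟨C, hC0, hC⟩ : ∃ C : ℝ, 0 < C ∧ ∀ z : E, l z = 0 → ‖z‖ ≤ C * ‖A₀ z‖ := by
    -- The bound is inherited from the invertible `D'`, which maps `(0, 0, z)` to `(0, 0, A₀ z)`
    -- when `l z = 0`.
    obtain ⟨K, hK⟩ : ∃ K, AntilipschitzWith K D' := ⟨_, D'.antilipschitz⟩
    refine ⟨K + 1, by positivity, fun z hz => ?_⟩
    have h1 := ZeroHomClass.bound_of_antilipschitz D' hK (0, 0, z)
    have h2 : D' (0, 0, z) = (0, 0, A₀ z) := by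
      change D (0, 0, z) = _
      rw [hD, desingularizedDeriv_apply]
      simp [hz, ← Prod.zero_eq_mk]
    rw [h2] at h1
    simp only [Prod.norm_mk, norm_zero] at h1
    rw [max_eq_right (norm_nonneg _), max_eq_right (norm_nonneg _), max_eq_right (norm_nonneg _),
      max_eq_right (norm_nonneg _)] at h1
    nlinarith [norm_nonneg (A₀ z)]
  obtain ⟨r, hr0, hr⟩ : ∃ r > 0, Metric.ball ((0, c₀, e) : ℝ × ℝ × E) r ⊆ Φ.source :=
    Metric.isOpen_iff.1 Φ.open_source _ hsrc
  -- The first smallness absorbs `‖z‖` into the left side of the estimate below; the second places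
  -- `s⁻¹ • h` within `r` of `e`.
  obtain ⟨δ, hδ0, hδ1, hδ2⟩ : ∃ δ : ℝ, 0 < δ ∧ C * δ ≤ 1 / 2 ∧ 2 * C * δ * ‖e‖ < r := by
    refine ⟨min (1 / (2 * C)) (r / (2 * (2 * C * (‖e‖ + 1)))), by positivity, ?_, ?_⟩
    · calc C * _ ≤ C * (1 / (2 * C)) := by gcongr; exact min_le_left _ _
        _ = 1 / 2 := by field_simp
    · calc 2 * C * _ * ‖e‖ ≤ 2 * C * (r / (2 * (2 * C * (‖e‖ + 1)))) * (‖e‖ + 1) := by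
            gcongr
            · exact min_le_right _ _
            · linarith
        _ = r / 2 := by field_simp
        _ < r := by linarith
  have hNW : ∀ᶠ q in 𝓝 ((c₀, 0) : ℝ × E), q ∈ N ∧ ‖A q - A₀‖ ≤ δ ∧ |q.1 - c₀| < r ∧ |l q.2| < r := by
    have h1 : ∀ᶠ q in 𝓝 ((c₀, 0) : ℝ × E), ‖A q - A₀‖ < δ := by
      have : ContinuousAt (fun q => ‖A q - A₀‖) ((c₀, 0) : ℝ × E) :=
        (hA.continuousAt.sub continuousAt_const).norm
      refine this.eventually_lt_const ?_
      simpa [← hA₀] using hδ0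
    have h2 : ∀ᶠ q in 𝓝 ((c₀, 0) : ℝ × E), |q.1 - c₀| < r := by
      have : ContinuousAt (fun q : ℝ × E => |q.1 - c₀|) ((c₀, 0) : ℝ × E) := by fun_prop
      refine this.eventually_lt_const ?_
      simpa using hr0
    have h3 : ∀ᶠ q in 𝓝 ((c₀, 0) : ℝ × E), |l q.2| < r := by
      have : ContinuousAt (fun q : ℝ × E => |l q.2|) ((c₀, 0) : ℝ × E) := by fun_prop
      refine this.eventually_lt_const ?_
      simpa using hr0
    filter_upwards [hN, h1, h2, h3] with q a b c d using ⟨a, b.le, c, d⟩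
  obtain ⟨W, hWN, hWo, hWm⟩ := eventually_nhds_iff.1 hNW
  have hsmall : ∀ᶠ s : ℝ in 𝓝 0, ((s, 1, 0) : ℝ × ℝ × E) ∈ Φ.target ∧
      ((Φ.symm (s, 1, 0)).2.1, s • (Φ.symm (s, 1, 0)).2.2) ∈ W := by
    refine Eventually.and ?_ ?_
    · refine hline.continuousAt.eventually_mem (Φ.open_target.mem_nhds ?_)
      have := Φ.map_source hsrc
      rwa [hcoe, hbase] at this
    · have : ContinuousAt (fun s : ℝ =>
          ((Φ.symm (s, 1, 0)).2.1, s • (Φ.symm (s, 1, 0)).2.2)) 0 :=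
        hΨ.continuousAt.prodMk (continuousAt_id.smul hV.continuousAt)
      refine this.eventually_mem (hWo.mem_nhds ?_)
      simpa [hsymm0] using hWm
  have key : ∀ s : ℝ, ((s, 1, 0) : ℝ × ℝ × E) ∈ Φ.target →
      l (Φ.symm (s, 1, 0)).2.2 = 1 ∧
      A ((Φ.symm (s, 1, 0)).2.1, s • (Φ.symm (s, 1, 0)).2.2) (Φ.symm (s, 1, 0)).2.2 = 0 := by
    intro s hs
    have h := Φ.right_inv hs
    rw [hcoe] at h
    simp only [desingularized, Prod.mk.injEq] at h
    obtain ⟨h1, h2, h3⟩ := h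
    rw [h1] at h3
    exact ⟨h2, h3⟩
  obtain ⟨ε₀, hε₀, hε⟩ := Metric.eventually_nhds_iff.1 hsmall
  filter_upwards [Ioo_mem_nhdsGT hε₀] with ε hεε
  have hε' : ∀ s : ℝ, |s| < ε → ((s, 1, 0) : ℝ × ℝ × E) ∈ Φ.target ∧
      ((Φ.symm (s, 1, 0)).2.1, s • (Φ.symm (s, 1, 0)).2.2) ∈ W := by
    intro s hs
    apply hε
    rw [Real.dist_eq, sub_zero]
    exact hs.trans hεε.2
  -- On the curve `l (s • V s) = s`, so the condition on `l` cuts out exactly the parameters with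
  -- `|s| < ε`.
  refine ⟨fun s hs => ?_, W ∩ {q | |l q.2| < ε}, hWo.inter ?_, ⟨hWm, ?_⟩, ?_, ?_⟩
  · rw [map_smul, (key s (hε' s hs).1).2, smul_zero]
  · exact isOpen_lt (by fun_prop) continuous_const
  · simpa using hεε.1
  · exact fun q hq => (hWN q hq.1).1
  · ext ⟨c, h⟩
    simp only [mem_ofPred_eq, mem_inter_iff, Prod.mk.injEq]
    constructor
    · rintro ⟨⟨hW, hlε⟩, hzero, hne⟩
      obtain ⟨-, hδ, hcr, hlr⟩ := hWN _ hW
      simp only at hδ hcr hlr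
      set s := l h with hs
      set z := h - s • e with hz
      have hlz : l z = 0 := by simp [hz, hle, ← hs]
      have hA₀h : ‖A₀ z‖ ≤ δ * ‖h‖ := by
        have h1 : A₀ z = -((A (c, h) - A₀) h) := by
          rw [hz, map_sub, map_smul, hA₀e, smul_zero, sub_zero, sub_apply,
            hzero, zero_sub, neg_neg]
        rw [h1, norm_neg]
        exact (ContinuousLinearMap.le_opNorm _ _).trans (by gcongr)
      -- The part of a solution transverse to `e` is controlled by its `e`-component `s`. Thus `s =
      -- 0` would force `h = 0`.
      have hzb : ‖z‖ ≤ 2 * C * δ * ‖e‖ * |s| := by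
        have h1 : ‖z‖ ≤ C * (δ * ‖h‖) := (hC z hlz).trans (by gcongr)
        have h2 : ‖h‖ ≤ |s| * ‖e‖ + ‖z‖ := by
          calc ‖h‖ = ‖s • e + z‖ := by rw [hz]; congr 1; abel
            _ ≤ ‖s • e‖ + ‖z‖ := norm_add_le _ _
            _ = _ := by rw [norm_smul, Real.norm_eq_abs]
        have h3 : C * δ * ‖h‖ ≤ C * δ * (|s| * ‖e‖ + ‖z‖) := by gcongr
        have h4 : C * δ * ‖z‖ ≤ 1 / 2 * ‖z‖ := by gcongr
        linarith
      have hs0 : s ≠ 0 := by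
        intro h0
        rw [h0, abs_zero, mul_zero] at hzb
        have : z = 0 := norm_le_zero_iff.1 hzb
        rw [hz, h0, zero_smul, sub_zero] at this
        exact hne this
      have hv : ‖s⁻¹ • h - e‖ < r := by
        have h1 : s⁻¹ • h - e = s⁻¹ • z := by
          rw [hz, smul_sub, smul_smul, inv_mul_cancel₀ hs0, one_smul]
        rw [h1, norm_smul, norm_inv, Real.norm_eq_abs, inv_mul_lt_iff₀ (abs_pos.2 hs0)]
        nlinarith [abs_pos.2 hs0]
      have hmem : (s, c, s⁻¹ • h) ∈ Φ.source := by
        apply hr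
        rw [Metric.mem_ball, Prod.dist_eq, Prod.dist_eq, dist_eq_norm, dist_eq_norm, dist_eq_norm]
        simp only [sub_zero, Real.norm_eq_abs]
        exact max_lt hlr (max_lt hcr hv)
      have himg : Φ (s, c, s⁻¹ • h) = (s, 1, 0) := by
        rw [hcoe]
        simp only [desingularized, Prod.mk.injEq, true_and]
        refine ⟨?_, ?_⟩
        · rw [map_smul, ← hs, smul_eq_mul, inv_mul_cancel₀ hs0]
        · rw [smul_smul, mul_inv_cancel₀ hs0, one_smul, map_smul, hzero, smul_zero]
      have hinv : Φ.symm (s, 1, 0) = (s, c, s⁻¹ • h) := by rw [← himg]; exact Φ.left_inv hmem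
      refine ⟨s, abs_pos.2 hs0, hlε, ?_, ?_⟩
      · rw [hinv]
      · rw [hinv, smul_smul, mul_inv_cancel₀ hs0, one_smul]
    · rintro ⟨s, hs0, hsε, rfl, rfl⟩
      obtain ⟨h1, h2⟩ := hε' s hsε
      obtain ⟨k1, k2⟩ := key s h1
      refine ⟨⟨h2, ?_⟩, ?_, ?_⟩
      · rw [map_smul, k1, smul_eq_mul, mul_one]; exact hsε
      · rw [map_smul, k2, smul_zero]
      · intro h0
        have := congrArg l h0
        rw [map_smul, k1, smul_eq_mul, mul_one, map_zero] at this
        rw [this, abs_zero] at hs0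
        exact lt_irrefl _ hs0

end Bifurcation

/-! ### Taylor bounds for analytic germs -/

theorem exists_norm_sub_le_of_analyticAt {E : Type*} [NormedAddCommGroup E] [NormedSpace ℝ E]
    {V : ℝ → E} (hV : AnalyticAt ℝ V 0) :
    ∃ C : ℝ, ∀ᶠ s in 𝓝 (0 : ℝ), ‖V s - V 0‖ ≤ C * |s| := by
  obtain ⟨C, hC⟩ := hV.differentiableAt.isBigO_sub.bound
  exact ⟨C, by simpa using hC⟩

theorem exists_taylor_two_bound {f : ℝ → ℝ} (hf : AnalyticAt ℝ f 0) :
    ∃ C : ℝ, ∀ᶠ s in 𝓝 (0 : ℝ),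
      |f s - (f 0 + deriv f 0 * s + 1 / 2 * iteratedDeriv 2 f 0 * s ^ 2)| ≤ C * |s| ^ 3 := by
  obtain ⟨P, hP⟩ := id hf
  obtain ⟨C, hC⟩ := (hP.isBigO_sub_partialSum_pow 3).bound
  -- Power series expansions in one variable are unique, so `P` is the Taylor series.
  have hcoeff : ∀ n : ℕ, ∀ s : ℝ, P n (fun _ => s) = iteratedDeriv n f 0 / n.factorial * s ^ n := by
    intro n s
    have := hf.hasFPowerSeriesAt
    have h2 := hP.eq_formalMultilinearSeries this
    rw [h2, FormalMultilinearSeries.ofScalars_apply_eq, smul_eq_mul]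
  refine ⟨C, hC.mono fun s hs => ?_⟩
  simp only [FormalMultilinearSeries.partialSum, Finset.sum_range_succ, Finset.range_zero,
    Finset.sum_empty, hcoeff, zero_add] at hs
  simp at hs
  convert hs using 3
  ring

/-! ### Analytic functional calculus in a Banach algebra -/

section FunctionalCalculus

variable {B : Type*} [NormedCommRing B] [NormedAlgebra ℝ B] [NormOneClass B] [CompleteSpace B]

/-- An analytic germ at `0` acts on a Banach algebra near `0`, compatibly with characters. -/
theorem exists_analyticAt_functionalCalculus {g : ℝ → ℝ} (hg : AnalyticAt ℝ g 0) :
    ∃ G : B → B, AnalyticAt ℝ G 0 ∧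
      ∀ᶠ h in 𝓝 (0 : B), ∀ χ : B →A[ℝ] ℝ, (∀ b, |χ b| ≤ ‖b‖) → χ (G h) = g (χ h) := by
  obtain ⟨P, r, hP⟩ := hg
  set c : ℕ → ℝ := fun n => P.coeff n with hc
  set Q := FormalMultilinearSeries.ofScalars B c with hQ
  -- Because `‖1‖ = 1` in `B`, both norms equal `|c n|`, so no radius of convergence is lost.
  have hnorm : ∀ n, ‖Q n‖ = ‖P n‖ := by
    intro n
    rw [hQ, FormalMultilinearSeries.ofScalars_norm, hc, FormalMultilinearSeries.norm_apply_eq_norm_coef]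
  have hrad : P.radius ≤ Q.radius := by
    refine FormalMultilinearSeries.radius_le_of_le (fun n => ?_)
    rw [hnorm]
  have hpos : 0 < Q.radius := hP.r_pos.trans_le (hP.r_le.trans hrad)
  have hQs := Q.hasFPowerSeriesOnBall hpos
  refine ⟨Q.sum, hQs.analyticAt, ?_⟩
  filter_upwards [Metric.eball_mem_nhds (0 : B) hP.r_pos] with h hh χ hχ
  have h1 : HasSum (fun n => c n • h ^ n) (Q.sum h) := by
    have := hQs.hasSum (y := h) (Metric.eball_subset_eball (hP.r_le.trans hrad) hh)
    simpa [hQ, FormalMultilinearSeries.ofScalars_apply_eq] using this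
  have h2 : HasSum (fun n => c n • (χ h) ^ n) (χ (Q.sum h)) := by
    have := h1.map χ χ.cont
    simpa [Function.comp_def, map_pow] using this
  have h3 : HasSum (fun n => c n • (χ h) ^ n) (g (χ h)) := by
    have hy : χ h ∈ Metric.eball (0 : ℝ) r := by
      rw [Metric.mem_eball, edist_zero_right] at hh ⊢
      refine lt_of_le_of_lt ?_ hh
      rw [enorm_le_iff_norm_le]
      exact hχ h
    have := hP.hasSum hy
    simpa [hc, FormalMultilinearSeries.apply_eq_pow_smul_coeff, mul_comm] using this
  exact h2.unique h3

end FunctionalCalculus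

/-! ### Functions with a prescribed second derivative -/

section SecondDerivative

/-- The function `g` is the second derivative of `u`. -/
def HasSecondDeriv (u g : ℝ → ℝ) : Prop :=
  ∃ u' : ℝ → ℝ, (∀ x, HasDerivAt u (u' x) x) ∧ ∀ x, HasDerivAt u' (g x) x

theorem hasSecondDeriv_iff {u g : ℝ → ℝ} (hg : Continuous g) :
    HasSecondDeriv u g ↔ ContDiff ℝ 2 u ∧ ∀ x, iteratedDeriv 2 u x = g x := by
  constructor
  · rintro ⟨u', h1, h2⟩
    have e1 : deriv u = u' := funext fun x => (h1 x).deriv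
    have e2 : deriv u' = g := funext fun x => (h2 x).deriv
    refine ⟨?_, fun x => ?_⟩
    · rw [show (2 : WithTop ℕ∞) = 1 + 1 by norm_num, contDiff_succ_iff_deriv]
      refine ⟨fun x => (h1 x).differentiableAt, by simp, ?_⟩
      rw [e1, contDiff_one_iff_deriv, e2]
      exact ⟨fun x => (h2 x).differentiableAt, hg⟩
    · rw [iteratedDeriv_succ, iteratedDeriv_one, e1, e2]
  · rintro ⟨h1, h2⟩
    have h3 : ContDiff ℝ 1 (deriv u) := by
      rw [show (2 : WithTop ℕ∞) = 1 + 1 by norm_num, contDiff_succ_iff_deriv] at h1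
      exact h1.2.2
    refine ⟨deriv u, fun x => (h1.differentiable (by norm_num) x).hasDerivAt, fun x => ?_⟩
    rw [← h2, iteratedDeriv_succ, iteratedDeriv_one]
    exact (h3.differentiable (by norm_num) x).hasDerivAt

theorem HasSecondDeriv.sub {u v g h : ℝ → ℝ} (hu : HasSecondDeriv u g) (hv : HasSecondDeriv v h) :
    HasSecondDeriv (fun x => u x - v x) (fun x => g x - h x) := by
  obtain ⟨u', h1, h2⟩ := hu
  obtain ⟨v', h3, h4⟩ := hv
  exact ⟨fun x => u' x - v' x, fun x => (h1 x).sub (h3 x), fun x => (h2 x).sub (h4 x)⟩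

theorem HasSecondDeriv.add {u v g h : ℝ → ℝ} (hu : HasSecondDeriv u g) (hv : HasSecondDeriv v h) :
    HasSecondDeriv (fun x => u x + v x) (fun x => g x + h x) := by
  obtain ⟨u', h1, h2⟩ := hu
  obtain ⟨v', h3, h4⟩ := hv
  exact ⟨fun x => u' x + v' x, fun x => (h1 x).add (h3 x), fun x => (h2 x).add (h4 x)⟩

theorem HasSecondDeriv.const_mul {u g : ℝ → ℝ} (hu : HasSecondDeriv u g) (a : ℝ) :
    HasSecondDeriv (fun x => a * u x) (fun x => a * g x) := by
  obtain ⟨u', h1, h2⟩ := hu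
  exact ⟨fun x => a * u' x, fun x => (h1 x).const_mul a, fun x => (h2 x).const_mul a⟩

theorem hasSecondDeriv_const (a : ℝ) : HasSecondDeriv (fun _ => a) (fun _ => 0) :=
  ⟨fun _ => 0, fun x => hasDerivAt_const x a, fun x => hasDerivAt_const x 0⟩

theorem HasSecondDeriv.congr {u g h : ℝ → ℝ} (hu : HasSecondDeriv u g) (he : ∀ x, g x = h x) :
    HasSecondDeriv u h := by
  rwa [← funext he]

theorem HasSecondDeriv.congr' {u v g h : ℝ → ℝ} (hu : HasSecondDeriv u g) (he : ∀ x, u x = v x)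
    (he' : ∀ x, g x = h x) : HasSecondDeriv v h := by
  rwa [← funext he, ← funext he']

/-- The second derivative is nonpositive at a global maximum. -/
theorem HasSecondDeriv.nonpos_of_forall_le {u g : ℝ → ℝ} (hu : HasSecondDeriv u g) {x₀ : ℝ}
    (hmax : ∀ x, u x ≤ u x₀) : g x₀ ≤ 0 := by
  obtain ⟨u', h1, h2⟩ := hu
  by_contra! hpos
  have e1 : deriv u = u' := funext fun x => (h1 x).deriv
  have hmax' : IsLocalMax u x₀ := Eventually.of_forall hmax
  -- A positive second derivative makes the maximum also a local minimum. Then `u` is locally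
  -- constant and its second derivative vanishes.
  have hmin : IsLocalMin u x₀ := by
    apply isLocalMin_of_deriv_deriv_pos
    · rw [e1, (h2 x₀).deriv]; exact hpos
    · exact hmax'.deriv_eq_zero
    · exact (h1 x₀).continuousAt
  have heq : u =ᶠ[𝓝 x₀] fun _ => u x₀ := by
    filter_upwards [hmin] with x hx using le_antisymm (hmax x) hx
  have h3 : u' =ᶠ[𝓝 x₀] fun _ => 0 := by
    have := heq.deriv
    rw [e1] at this
    simpa using this
  have h4 := h3.deriv_eq
  rw [(h2 x₀).deriv, deriv_const] at h4
  exact hpos.ne' h4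

end SecondDerivative

/-! ### Even periodic solutions of u'' = a u - f -/

section LinearODE

/-- The fundamental pair of solutions of `w'' = a w` at `0`. -/
structure IsFundamentalPair (a : ℝ) (C S : ℝ → ℝ) : Prop where
  hasDerivAt_fst : ∀ x, HasDerivAt C (a * S x) x
  hasDerivAt_snd : ∀ x, HasDerivAt S (C x) x
  fst_zero : C 0 = 1
  snd_zero : S 0 = 0

variable {a : ℝ} {C S : ℝ → ℝ}

theorem isFundamentalPair_hyperbolic : IsFundamentalPair 1 Real.cosh Real.sinh where
  hasDerivAt_fst x := by simpa using Real.hasDerivAt_cosh x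
  hasDerivAt_snd x := Real.hasDerivAt_sinh x
  fst_zero := Real.cosh_zero
  snd_zero := Real.sinh_zero

theorem isFundamentalPair_trigonometric {k : ℝ} (hk : k ≠ 0) :
    IsFundamentalPair (-k ^ 2) (fun x => Real.cos (k * x)) (fun x => Real.sin (k * x) / k) where
  hasDerivAt_fst x := by
    have h := ((hasDerivAt_id x).const_mul k).cos
    refine h.congr_deriv ?_
    simp only [id, mul_one]
    field_simp
  hasDerivAt_snd x := by
    have h := ((hasDerivAt_id x).const_mul k).sin.div_const k
    refine h.congr_deriv ?_
    simp only [id, mul_one]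
    field_simp
  fst_zero := by simp
  snd_zero := by simp

theorem eq_of_hasDerivAt_zero {u : ℝ → ℝ} (h : ∀ x, HasDerivAt u 0 x) (x y : ℝ) : u x = u y :=
  is_const_of_deriv_eq_zero (fun x => (h x).differentiableAt) (fun x => (h x).deriv) x y

theorem IsFundamentalPair.sq_sub (h : IsFundamentalPair a C S) (x : ℝ) :
    C x ^ 2 - a * S x ^ 2 = 1 := by
  have hd : ∀ x, HasDerivAt (fun x => C x ^ 2 - a * S x ^ 2) 0 x := fun x => by
    have := ((h.hasDerivAt_fst x).pow 2).sub (((h.hasDerivAt_snd x).pow 2).const_mul a)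
    refine this.congr_deriv ?_
    ring
  rw [eq_of_hasDerivAt_zero hd x 0, h.fst_zero, h.snd_zero]
  ring

/-- The two Wronskian-type expressions `w C - w' S` and `w' C - a w S` are constant, and `C² - a S²
= 1` lets them be solved for `w`. This gives uniqueness without a general Cauchy theorem. -/
theorem IsFundamentalPair.eq_of_ode (h : IsFundamentalPair a C S) {w w' : ℝ → ℝ}
    (h1 : ∀ x, HasDerivAt w (w' x) x) (h2 : ∀ x, HasDerivAt w' (a * w x) x) (x : ℝ) :
    w x = w 0 * C x + w' 0 * S x := by
  have d1 : ∀ x, HasDerivAt (fun x => w x * C x - w' x * S x) 0 x := fun x => by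
    refine (((h1 x).mul (h.hasDerivAt_fst x)).sub ((h2 x).mul (h.hasDerivAt_snd x))).congr_deriv ?_
    ring
  have d2 : ∀ x, HasDerivAt (fun x => w' x * C x - a * (w x * S x)) 0 x := fun x => by
    refine (((h2 x).mul (h.hasDerivAt_fst x)).sub
      (((h1 x).mul (h.hasDerivAt_snd x)).const_mul a)).congr_deriv ?_
    ring
  have e1 := eq_of_hasDerivAt_zero d1 x 0
  have e2 := eq_of_hasDerivAt_zero d2 x 0
  simp only [h.fst_zero, h.snd_zero, mul_one, mul_zero, sub_zero] at e1 e2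
  linear_combination (C x) * e1 + (S x) * e2 - (w x) * h.sq_sub x

theorem IsFundamentalPair.eq_zero_of_ode (h : IsFundamentalPair a C S) {w w' : ℝ → ℝ}
    (h1 : ∀ x, HasDerivAt w (w' x) x) (h2 : ∀ x, HasDerivAt w' (a * w x) x)
    (h3 : w 0 = 0) (h4 : w' 0 = 0) (x : ℝ) : w x = 0 := by
  rw [h.eq_of_ode h1 h2 x, h3, h4]; ring

theorem deriv_zero_of_even {u u' : ℝ → ℝ} (h1 : ∀ x, HasDerivAt u (u' x) x)
    (he : ∀ x, u (-x) = u x) (x : ℝ) : u' (-x) = -u' x := by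
  have h := (h1 (-x)).comp x (hasDerivAt_neg x)
  rw [show u ∘ Neg.neg = u from funext he] at h
  linarith [h.unique (h1 x)]

/-- Even periodic solutions of `u'' = a u - f` by variation of constants. -/
theorem IsFundamentalPair.exists_even_periodic (h : IsFundamentalPair a C S) {f : ℝ → ℝ}
    (hf : Continuous f) (hfe : ∀ x, f (-x) = f x) {L : ℝ} (hfp : ∀ x, f (x + L) = f x) {A : ℝ}
    (hA : a * S (L / 2) * (A + ∫ t in (0 : ℝ)..(L / 2), S t * f t) =
      C (L / 2) * ∫ t in (0 : ℝ)..(L / 2), C t * f t) :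
    ∃ u : ℝ → ℝ, HasSecondDeriv u (fun x => a * u x - f x) ∧ (∀ x, u (-x) = u x) ∧
      ∀ x, u (x + L) = u x := by
  have hCc : Continuous C := continuous_iff_continuousAt.2 fun x => (h.hasDerivAt_fst x).continuousAt
  have hSc : Continuous S := continuous_iff_continuousAt.2 fun x => (h.hasDerivAt_snd x).continuousAt
  have hP : ∀ x, HasDerivAt (fun x => ∫ t in (0 : ℝ)..x, C t * f t) (C x * f x) x := fun x =>
    intervalIntegral.integral_hasDerivAt_right ((hCc.mul hf).intervalIntegrable _ _)
      ((hCc.mul hf).stronglyMeasurableAtFilter _ _) (hCc.mul hf).continuousAt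
  have hQ : ∀ x, HasDerivAt (fun x => ∫ t in (0 : ℝ)..x, S t * f t) (S x * f x) x := fun x =>
    intervalIntegral.integral_hasDerivAt_right ((hSc.mul hf).intervalIntegrable _ _)
      ((hSc.mul hf).stronglyMeasurableAtFilter _ _) (hSc.mul hf).continuousAt
  set P : ℝ → ℝ := fun x => ∫ t in (0 : ℝ)..x, C t * f t with hPdef
  set Q : ℝ → ℝ := fun x => ∫ t in (0 : ℝ)..x, S t * f t with hQdef
  have hP0 : P 0 = 0 := by simp [hPdef]
  have hQ0 : Q 0 = 0 := by simp [hQdef]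
  -- Variation of constants with `u 0 = A` and `u' 0 = 0`; hypothesis `hA` says exactly that `u' (L
  -- / 2) = 0`.
  set u : ℝ → ℝ := fun x => C x * (A + Q x) - S x * P x with hu
  set u' : ℝ → ℝ := fun x => a * S x * (A + Q x) - C x * P x with hu'
  have h1 : ∀ x, HasDerivAt u (u' x) x := fun x => by
    refine (((h.hasDerivAt_fst x).mul ((hQ x).const_add A)).sub
      ((h.hasDerivAt_snd x).mul (hP x))).congr_deriv ?_
    simp only [hu']
    ring
  have h2 : ∀ x, HasDerivAt u' (a * u x - f x) x := fun x => by
    refine ((((h.hasDerivAt_snd x).const_mul a).mul ((hQ x).const_add A)).sub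
      ((h.hasDerivAt_fst x).mul (hP x))).congr_deriv ?_
    simp only [hu]
    linear_combination (-f x) * h.sq_sub x
  have hu0 : u' 0 = 0 := by simp [hu', hP0, h.snd_zero]
  have heven : ∀ x, u (-x) = u x := by
    intro x
    have k1 : ∀ x, HasDerivAt (fun x => u (-x) - u x) (-u' (-x) - u' x) x := fun x => by
      have := ((h1 (-x)).scomp x (hasDerivAt_neg x)).sub (h1 x)
      exact this.congr_deriv (by simp)
    have k2 : ∀ x, HasDerivAt (fun x => -u' (-x) - u' x) (a * (u (-x) - u x)) x := fun x => by
      have := ((h2 (-x)).scomp x (hasDerivAt_neg x)).neg.sub (h2 x)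
      refine this.congr_deriv ?_
      rw [hfe, smul_eq_mul]
      ring
    have := h.eq_zero_of_ode k1 k2 (by simp) (by simp [hu0]) x
    linarith
  have hend : u' (L / 2) = 0 := by simp only [hu']; rw [hA]; ring
  refine ⟨u, ⟨u', h1, h2⟩, heven, fun x => ?_⟩
  -- This difference solves the homogeneous equation. At `0` its value vanishes by evenness, and its
  -- derivative is `2 * u' (L / 2) = 0`.
  have k1 : ∀ x, HasDerivAt (fun x => u (x + L / 2) - u (x - L / 2))
      (u' (x + L / 2) - u' (x - L / 2)) x := fun x =>
    ((h1 (x + L / 2)).comp_add_const x _).sub ((h1 (x - L / 2)).comp_sub_const x _)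
  have k2 : ∀ x, HasDerivAt (fun x => u' (x + L / 2) - u' (x - L / 2))
      (a * (u (x + L / 2) - u (x - L / 2))) x := fun x => by
    refine (((h2 (x + L / 2)).comp_add_const x _).sub
      ((h2 (x - L / 2)).comp_sub_const x _)).congr_deriv ?_
    have := hfp (x - L / 2)
    rw [show x - L / 2 + L = x + L / 2 by ring] at this
    rw [this]
    ring
  have := h.eq_zero_of_ode k1 k2 (by simp [heven])
    (by rw [zero_add, zero_sub, deriv_zero_of_even h1 heven, hend]; simp) (x + L / 2)
  rw [show x + L / 2 + L / 2 = x + L by ring, add_sub_cancel_right] at this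
  linarith

end LinearODE

/-! ### Even functions on the torus, maximum principle and resolvent -/

section Torus

variable {L : ℝ}

/-- The algebra of even continuous functions on the torus. -/
def evenSubalgebra (L : ℝ) : Subalgebra ℝ C(AddCircle L, ℝ) where
  carrier := {f | ∀ x : AddCircle L, f (-x) = f x}
  add_mem' := by
    intro f g hf hg x
    simp [hf x, hg x]
  mul_mem' := by
    intro f g hf hg x
    simp [hf x, hg x]
  algebraMap_mem' := by
    intro r x
    simp

theorem isClosed_evenSubalgebra : IsClosed (evenSubalgebra L : Set C(AddCircle L, ℝ)) := by
  have : (evenSubalgebra L : Set C(AddCircle L, ℝ)) =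
      ⋂ x : AddCircle L, {f : C(AddCircle L, ℝ) | f (-x) = f x} := by
    ext f
    simp only [mem_iInter]
    rfl
  rw [this]
  exact isClosed_iInter fun x => isClosed_eq (continuous_eval_const _)
    (continuous_eval_const _)

/-- The type of even continuous functions on the torus, a Banach algebra. -/
def EvenFun (L : ℝ) : Type := evenSubalgebra L

/-- The periodic function on the line given by a function on the torus. -/
def onLine (f : C(AddCircle L, ℝ)) (x : ℝ) : ℝ := f (x : AddCircle L)

theorem continuous_onLine (f : C(AddCircle L, ℝ)) : Continuous (onLine f) :=
  f.continuous.comp (AddCircle.continuous_mk' L)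

theorem onLine_add_period (f : C(AddCircle L, ℝ)) (x : ℝ) : onLine f (x + L) = onLine f x := by
  simp [onLine]

theorem onLine_neg (f : EvenFun L) (x : ℝ) : onLine f.1 (-x) = onLine f.1 x :=
  f.2 (x : AddCircle L)

theorem onLine_injective {f g : C(AddCircle L, ℝ)} (h : ∀ x, onLine f x = onLine g x) : f = g := by
  ext x
  induction x using QuotientAddGroup.induction_on with
  | H x => exact h x

theorem exists_onLine_eq {u : ℝ → ℝ} (hu : Continuous u) (he : ∀ x, u (-x) = u x)
    (hp : ∀ x, u (x + L) = u x) : ∃ f : EvenFun L, ∀ x, onLine f.1 x = u x := by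
  refine ⟨⟨⟨Function.Periodic.lift (f := u) hp, continuous_quot_lift _ hu⟩, fun x => ?_⟩,
    fun x => rfl⟩
  induction x using QuotientAddGroup.induction_on with
  | H x => exact he x

theorem solvesH_iff {f φ : C(AddCircle L, ℝ)} :
    SolvesH f φ ↔ HasSecondDeriv (onLine φ) (fun x => Real.exp (onLine φ x) - onLine f x) := by
  rw [hasSecondDeriv_iff (by
    exact (Real.continuous_exp.comp (continuous_onLine φ)).sub (continuous_onLine f))]
  refine and_congr Iff.rfl (forall_congr' fun x => ?_)
  change -iteratedDeriv 2 (onLine φ) x + Real.exp (onLine φ x) = onLine f x ↔ _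
  constructor <;> intro h <;> linarith

variable [hL : Fact (0 < L)]

instance evenFunNormedCommRing : NormedCommRing (EvenFun L) := Subalgebra.normedCommRing (evenSubalgebra L)

instance evenFunNormedAlgebra : NormedAlgebra ℝ (EvenFun L) := Subalgebra.toNormedAlgebra (evenSubalgebra L)

instance : NormOneClass (EvenFun L) := ⟨norm_one (α := C(AddCircle L, ℝ))⟩

instance : CompleteSpace (EvenFun L) := isClosed_evenSubalgebra.completeSpace_coe

@[simp] theorem onLine_add (f g : EvenFun L) (x : ℝ) :
    onLine (f + g).1 x = onLine f.1 x + onLine g.1 x := rfl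

@[simp] theorem onLine_sub (f g : EvenFun L) (x : ℝ) :
    onLine (f - g).1 x = onLine f.1 x - onLine g.1 x := rfl

@[simp] theorem onLine_mul (f g : EvenFun L) (x : ℝ) :
    onLine (f * g).1 x = onLine f.1 x * onLine g.1 x := rfl

@[simp] theorem onLine_smul (a : ℝ) (f : EvenFun L) (x : ℝ) :
    onLine (a • f).1 x = a * onLine f.1 x := rfl

@[simp] theorem onLine_zero (x : ℝ) : onLine (0 : EvenFun L).1 x = 0 := rfl

@[simp] theorem onLine_one (x : ℝ) : onLine (1 : EvenFun L).1 x = 1 := rfl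

theorem evenFun_norm_def (f : EvenFun L) : ‖f‖ = ‖f.1‖ := rfl

/-- Evaluation at a point of the line, as a continuous character. -/
def evalCharacter (L x : ℝ) [Fact (0 < L)] : EvenFun L →A[ℝ] ℝ :=
  { (ContinuousMap.evalAlgHom ℝ ℝ (x : AddCircle L)).comp (evenSubalgebra L).val with
    cont := (continuous_eval_const (x : AddCircle L)).comp continuous_subtype_val }

theorem evalCharacter_apply (x : ℝ) (f : EvenFun L) :
    evalCharacter L x f = onLine f.1 x := rfl

/-- The underlying bijection of `evenEquiv`. -/
def evenFunEquiv (L : ℝ) : EvenFun L ≃ CEven L where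
  toFun f := ⟨f.1, f.2⟩
  invFun f := ⟨f.1, f.2⟩

theorem evenFunEquiv_add (f g : EvenFun L) :
    evenFunEquiv L (f + g) = evenFunEquiv L f + evenFunEquiv L g := rfl

theorem evenFunEquiv_smul (a : ℝ) (f : EvenFun L) :
    evenFunEquiv L (a • f) = a • evenFunEquiv L f := rfl

theorem evenFunEquiv_one : evenFunEquiv L 1 = evenOne L := rfl

attribute [irreducible] evenFunNormedCommRing evenFunNormedAlgebra

/-- The identification of the algebra of even functions with `CEven L`. -/
def evenEquiv (L : ℝ) [Fact (0 < L)] : EvenFun L ≃ₗᵢ[ℝ] CEven L where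
  toEquiv := evenFunEquiv L
  map_add' := evenFunEquiv_add
  map_smul' := evenFunEquiv_smul
  norm_map' f := (evenFun_norm_def f).symm

theorem evenEquiv_coe (f : EvenFun L) : (evenEquiv L f).1 = f.1 := rfl

theorem evenEquiv_one : evenEquiv L 1 = evenOne L := evenFunEquiv_one


/-- Maximum principle on the torus. -/
theorem nonpos_of_hasSecondDeriv {w : C(AddCircle L, ℝ)} {g : ℝ → ℝ}
    (hw : HasSecondDeriv (onLine w) g) (h : ∀ x, 0 < onLine w x → 0 < g x) (x : ℝ) :
    onLine w x ≤ 0 := by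
  obtain ⟨y, -, hy⟩ := isCompact_univ.exists_isMaxOn (s := (univ : Set (AddCircle L)))
    ⟨0, mem_univ _⟩ w.continuous.continuousOn
  induction y using QuotientAddGroup.induction_on with
  | H y =>
    have hmax : ∀ x, onLine w x ≤ onLine w y := fun x => hy (mem_univ (x : AddCircle L))
    have h1 := hw.nonpos_of_forall_le hmax
    by_contra! hx
    exact (h y (hx.trans_le (hmax x))).not_ge h1

/-- Where `φ > ψ`, monotonicity of `exp` makes `(φ - ψ)'' > 0`, so the maximum principle excludes
it. No smallness is needed. -/
theorem solvesH_unique {f φ ψ : C(AddCircle L, ℝ)} (hφ : SolvesH f φ) (hψ : SolvesH f ψ) :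
    φ = ψ := by
  have aux : ∀ {φ ψ : C(AddCircle L, ℝ)}, SolvesH f φ → SolvesH f ψ →
      ∀ x, onLine φ x ≤ onLine ψ x := by
    intro φ ψ hφ hψ x
    have h := (solvesH_iff.1 hφ).sub (solvesH_iff.1 hψ)
    have := nonpos_of_hasSecondDeriv (w := φ - ψ) h (fun x hx => by
      have : onLine ψ x < onLine φ x := by simpa [onLine] using hx
      have := Real.exp_lt_exp.2 this
      linarith) x
    simpa [onLine] using this
  exact onLine_injective fun x => le_antisymm (aux hφ hψ x) (aux hψ hφ x)

theorem abs_onLine_le (f : C(AddCircle L, ℝ)) (x : ℝ) : |onLine f x| ≤ ‖f‖ :=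
  f.norm_coe_le_norm (x : AddCircle L)

theorem onLine_le_of_resolvent {f u : C(AddCircle L, ℝ)}
    (h : HasSecondDeriv (onLine u) (fun x => onLine u x - onLine f x)) {M : ℝ}
    (hM : ∀ x, onLine f x ≤ M) (x : ℝ) : onLine u x ≤ M := by
  have h1 := h.sub (hasSecondDeriv_const M)
  have := nonpos_of_hasSecondDeriv (w := u - ContinuousMap.const (AddCircle L) M)
    (g := fun x => onLine u x - onLine f x - 0) h1 (fun x hx => by
    have : M < onLine u x := by simpa [onLine] using hx
    linarith [hM x]) x
  simpa [onLine] using this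

theorem norm_le_of_resolvent {f u : C(AddCircle L, ℝ)}
    (h : HasSecondDeriv (onLine u) (fun x => onLine u x - onLine f x)) : ‖u‖ ≤ ‖f‖ := by
  rw [ContinuousMap.norm_le _ (norm_nonneg _)]
  intro x
  induction x using QuotientAddGroup.induction_on with
  | H x =>
    change |onLine u x| ≤ _
    rw [abs_le']
    refine ⟨onLine_le_of_resolvent h (fun x => (abs_le.1 (abs_onLine_le f x)).2) x, ?_⟩
    have h' : HasSecondDeriv (onLine (-u)) (fun x => onLine (-u) x - onLine (-f) x) := by
      convert h.const_mul (-1) using 1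
      · ext x; simp [onLine]
      · ext x; simp [onLine]; ring
    have := onLine_le_of_resolvent h'
      (fun x => by simpa [onLine] using (abs_le'.1 (abs_onLine_le f x)).2) x
    simpa [onLine] using this

/-- Since `sinh (L / 2) ≠ 0`, the initial value `A` can be chosen so that `u' (L / 2) = 0`. -/
theorem exists_resolvent (f : EvenFun L) : ∃ u : EvenFun L,
    HasSecondDeriv (onLine u.1) (fun x => onLine u.1 x - onLine f.1 x) := by
  have hL0 := hL.out
  have hs : Real.sinh (L / 2) ≠ 0 := (Real.sinh_pos_iff.2 (by linarith)).ne'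
  obtain ⟨u, h1, h2, h3⟩ := isFundamentalPair_hyperbolic.exists_even_periodic (L := L)
    (A := Real.cosh (L / 2) * (∫ t in (0 : ℝ)..(L / 2), Real.cosh t * onLine f.1 t) /
      Real.sinh (L / 2) - ∫ t in (0 : ℝ)..(L / 2), Real.sinh t * onLine f.1 t)
    (continuous_onLine f.1) (onLine_neg f) (onLine_add_period _)
    (by field_simp; ring)
  have hc : Continuous u := by
    obtain ⟨u', h, -⟩ := h1
    exact continuous_iff_continuousAt.2 fun x => (h x).continuousAt
  obtain ⟨v, hv⟩ := exists_onLine_eq hc h2 h3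
  obtain rfl : onLine v.1 = u := funext hv
  exact ⟨v, h1.congr fun x => by ring⟩

/-- The operator `(1 - ∂²)⁻¹` on even functions. -/
theorem exists_resolvent_clm (L : ℝ) [Fact (0 < L)] :
    ∃ K : EvenFun L →L[ℝ] EvenFun L, ∀ f u : EvenFun L,
      K f = u ↔ HasSecondDeriv (onLine u.1) (fun x => onLine u.1 x - onLine f.1 x) := by
  choose T hT using exists_resolvent (L := L)
  have huniq : ∀ f u : EvenFun L,
      HasSecondDeriv (onLine u.1) (fun x => onLine u.1 x - onLine f.1 x) →
      T f = u := by
    intro f u hu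
    have h := ((hT f).sub hu)
    have h' : HasSecondDeriv (onLine ((T f).1 - u.1))
        (fun x => onLine ((T f).1 - u.1) x - onLine (0 : C(AddCircle L, ℝ)) x) := by
      refine HasSecondDeriv.congr h fun x => ?_
      simp [onLine]
    have := norm_le_of_resolvent h'
    rw [norm_zero, norm_le_zero_iff, sub_eq_zero] at this
    exact Subtype.ext this
  refine ⟨LinearMap.mkContinuous ⟨⟨T, fun f g => huniq _ _ ?_⟩, fun a f => huniq _ _ ?_⟩ 1 fun f => ?_,
    fun f u => ⟨?_, huniq f u⟩⟩
  · refine ((hT f).add (hT g)).congr' (fun x => (onLine_add _ _ x).symm) fun x => ?_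
    simp only [onLine_add]; ring
  · refine ((hT f).const_mul a).congr' (fun x => (onLine_smul _ _ x).symm) fun x => ?_
    simp only [onLine_smul, RingHom.id_apply]; ring
  · rw [one_mul, evenFun_norm_def, evenFun_norm_def]; exact norm_le_of_resolvent (hT f)
  · rintro rfl
    exact hT f

end Torus

/-! ### Spectral analysis of the resolvent at the cosine mode -/

section CosineMode

variable {L : ℝ}

/-- The function `cos (2πx / L)` as an element of the algebra of even functions. -/
def cosMode (L : ℝ) : EvenFun L := ⟨(evenCos L).1, (evenCos L).2⟩

theorem onLine_cosMode (x : ℝ) :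
    onLine (cosMode L).1 x = Real.cos (2 * Real.pi / L * x) := rfl

variable [hL : Fact (0 < L)]

/-- The coefficient of an even function along `cos (2πx / L)`. -/
def cosCoeff (L : ℝ) [hL : Fact (0 < L)] : EvenFun L →L[ℝ] ℝ :=
  LinearMap.mkContinuous
    { toFun := fun f => 4 / L * ∫ t in (0 : ℝ)..(L / 2), Real.cos (2 * Real.pi / L * t) * onLine f.1 t
      map_add' := fun f g => by
        have hc : Continuous fun t : ℝ => Real.cos (2 * Real.pi / L * t) := by fun_prop
        have hi : ∀ f : EvenFun L, IntervalIntegrable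
            (fun t => Real.cos (2 * Real.pi / L * t) * onLine f.1 t) MeasureTheory.volume 0 (L / 2) :=
          fun f => (hc.mul (continuous_onLine f.1)).intervalIntegrable _ _
        rw [← mul_add, ← intervalIntegral.integral_add (hi f) (hi g)]
        refine congrArg (fun z : ℝ => 4 / L * z) (intervalIntegral.integral_congr fun t _ => ?_)
        simp only [onLine_add]
        ring
      map_smul' := fun a f => by
        rw [RingHom.id_apply, smul_eq_mul, mul_left_comm, ← intervalIntegral.integral_const_mul a]
        refine congrArg (fun z : ℝ => 4 / L * z) (intervalIntegral.integral_congr fun t _ => ?_)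
        simp only [onLine_smul]
        ring } 2 fun f => by
    have hL0 := hL.out
    have h : ‖∫ t in (0 : ℝ)..(L / 2), Real.cos (2 * Real.pi / L * t) * onLine f.1 t‖ ≤
        ‖f‖ * |L / 2 - 0| := by
      refine intervalIntegral.norm_integral_le_of_norm_le_const fun t _ => ?_
      rw [norm_mul, Real.norm_eq_abs, Real.norm_eq_abs]
      calc _ ≤ 1 * ‖f‖ := mul_le_mul (Real.abs_cos_le_one _) ((abs_onLine_le f.1 t).trans_eq (evenFun_norm_def f).symm)
            (abs_nonneg _) zero_le_one
        _ = ‖f‖ := one_mul _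
    change ‖4 / L * _‖ ≤ _
    rw [norm_mul, Real.norm_of_nonneg (by positivity)]
    rw [sub_zero, abs_of_pos (by linarith)] at h
    calc _ ≤ 4 / L * (‖f‖ * (L / 2)) := by gcongr
      _ = 2 * ‖f‖ := by field_simp; ring

theorem cosCoeff_apply (f : EvenFun L) : cosCoeff L f =
    4 / L * ∫ t in (0 : ℝ)..(L / 2), Real.cos (2 * Real.pi / L * t) * onLine f.1 t := rfl

theorem waveNumber_pos : 0 < 2 * Real.pi / L := by
  have := hL.out
  positivity

theorem waveNumber_mul_half : 2 * Real.pi / L * (L / 2) = Real.pi := by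
  have := hL.out.ne'
  field_simp

theorem cosCoeff_cosMode : cosCoeff L (cosMode L) = 1 := by
  have hk := (waveNumber_pos (L := L)).ne'
  have hL0 := hL.out.ne'
  set k := 2 * Real.pi / L with hkdef
  -- An antiderivative of `cos²`; the half-period integral is `L / 4`, which the factor `4 / L`
  -- normalises.
  have hd : ∀ t ∈ uIcc 0 (L / 2), HasDerivAt
      (fun t => t / 2 + Real.sin (k * t) * Real.cos (k * t) / (2 * k))
      (Real.cos (k * t) * Real.cos (k * t)) t := fun t _ => by
    have h1 := ((hasDerivAt_id t).const_mul k).cos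
    have h2 := ((hasDerivAt_id t).const_mul k).sin
    refine (((hasDerivAt_id t).div_const 2).add ((h2.mul h1).div_const (2 * k))).congr_deriv ?_
    simp only [id, mul_one]
    have := Real.sin_sq_add_cos_sq (k * t)
    field_simp
    linear_combination -this
  rw [cosCoeff_apply]
  simp only [onLine_cosMode, ← hkdef]
  rw [intervalIntegral.integral_eq_sub_of_hasDerivAt hd
    (Continuous.intervalIntegrable (by fun_prop) _ _), hkdef, waveNumber_mul_half]
  simp
  field_simp
  norm_num

theorem hasSecondDeriv_cosMode :
    HasSecondDeriv (onLine (cosMode L).1)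
      (fun x => -(2 * Real.pi / L) ^ 2 * onLine (cosMode L).1 x) :=
  have h := isFundamentalPair_trigonometric (waveNumber_pos (L := L)).ne'
  ⟨_, h.hasDerivAt_fst, fun x => (h.hasDerivAt_snd x).const_mul _⟩

/-- The resolvent multiplies the cosine coefficient by its eigenvalue. -/
theorem cosCoeff_of_resolvent {f u : EvenFun L}
    (h : HasSecondDeriv (onLine u.1) (fun x => onLine u.1 x - onLine f.1 x)) :
    (1 + (2 * Real.pi / L) ^ 2) * cosCoeff L u = cosCoeff L f := by
  have hk := (waveNumber_pos (L := L)).ne'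
  obtain ⟨u', h1, h2⟩ := h
  have hu0 : u' 0 = 0 := by
    have := deriv_zero_of_even h1 (onLine_neg u) 0
    rw [neg_zero] at this
    linarith
  -- `u'` is odd and `L`-periodic, so `u' (L / 2) = u' (-(L / 2)) = -u' (L / 2)`.
  have huL : u' (L / 2) = 0 := by
    have e1 := deriv_zero_of_even h1 (onLine_neg u) (L / 2)
    have e2 : HasDerivAt (onLine u.1) (u' (-(L / 2) + L)) (-(L / 2)) := by
      have := (h1 (-(L / 2) + L)).comp_add_const (-(L / 2)) L
      rwa [show (fun x => onLine u.1 (x + L)) = onLine u.1 from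
        funext (onLine_add_period u.1)] at this
    have e3 := e2.unique (h1 _)
    rw [show -(L / 2) + L = L / 2 by ring] at e3
    linarith
  have hkL := waveNumber_mul_half (L := L)
  simp only [cosCoeff_apply]
  set k := 2 * Real.pi / L with hkdef
  -- Green's identity against the cosine: the boundary terms vanish since `u'` and `sin (k t)` are
  -- zero at both ends.
  have hd : ∀ t ∈ uIcc 0 (L / 2), HasDerivAt
      (fun t => u' t * Real.cos (k * t) + k * (onLine u.1 t * Real.sin (k * t)))
      ((1 + k ^ 2) * (Real.cos (k * t) * onLine u.1 t) - Real.cos (k * t) * onLine f.1 t) t :=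
    fun t _ => by
    have d1 := ((hasDerivAt_id t).const_mul k).cos
    have d2 := ((hasDerivAt_id t).const_mul k).sin
    refine (((h2 t).mul d1).add (((h1 t).mul d2).const_mul k)).congr_deriv ?_
    simp only [id, mul_one]
    ring
  have hc : Continuous fun t : ℝ => Real.cos (k * t) := by fun_prop
  have i1 : IntervalIntegrable (fun t => Real.cos (k * t) * onLine u.1 t) MeasureTheory.volume
      0 (L / 2) := (hc.mul (continuous_onLine u.1)).intervalIntegrable _ _
  have i2 : IntervalIntegrable (fun t => Real.cos (k * t) * onLine f.1 t) MeasureTheory.volume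
      0 (L / 2) := (hc.mul (continuous_onLine f.1)).intervalIntegrable _ _
  have := intervalIntegral.integral_eq_sub_of_hasDerivAt hd ((i1.const_mul _).sub i2)
  rw [intervalIntegral.integral_sub (i1.const_mul _) i2, intervalIntegral.integral_const_mul,
    hkL, hu0, huL] at this
  simp only [Real.sin_pi, mul_zero, zero_mul, Real.sin_zero, add_zero, sub_zero] at this
  linear_combination (4 / L) * this

/-- Evenness gives `w' 0 = 0` and removes the sine solution. This is what makes the eigenvalue
simple. -/
theorem eq_smul_cosMode {w : EvenFun L}
    (h : HasSecondDeriv (onLine w.1) (fun x => -(2 * Real.pi / L) ^ 2 * onLine w.1 x)) :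
    w = onLine w.1 0 • cosMode L := by
  obtain ⟨w', h1, h2⟩ := h
  have hw0 : w' 0 = 0 := by
    have := deriv_zero_of_even h1 (onLine_neg w) 0
    rw [neg_zero] at this
    linarith
  refine Subtype.ext (onLine_injective fun x => ?_)
  have h3 := (isFundamentalPair_trigonometric (waveNumber_pos (L := L)).ne').eq_of_ode h1 h2 x
  rw [h3, hw0, zero_mul, add_zero, onLine_smul, onLine_cosMode]

/-- Fredholm alternative at resonance: as `sin π = 0`, the periodicity condition no longer involves
`A` and reduces to the vanishing of the cosine coefficient. -/
theorem exists_resonant_solution {f : EvenFun L} (hf : cosCoeff L f = 0) :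
    ∃ u : EvenFun L, HasSecondDeriv (onLine u.1)
      (fun x => -(2 * Real.pi / L) ^ 2 * onLine u.1 x - onLine f.1 x) := by
  have hL0 := hL.out
  have hP : ∫ t in (0 : ℝ)..(L / 2), Real.cos (2 * Real.pi / L * t) * onLine f.1 t = 0 := by
    rw [cosCoeff_apply] at hf
    exact (mul_eq_zero.1 hf).resolve_left (by positivity)
  obtain ⟨u, h1, h2, h3⟩ := (isFundamentalPair_trigonometric
    (waveNumber_pos (L := L)).ne').exists_even_periodic (L := L) (A := 0)
    (continuous_onLine f.1) (onLine_neg f) (onLine_add_period _)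
    (by rw [hP, waveNumber_mul_half]; simp)
  have hc : Continuous u := by
    obtain ⟨u', h, -⟩ := h1
    exact continuous_iff_continuousAt.2 fun x => (h x).continuousAt
  obtain ⟨v, hv⟩ := exists_onLine_eq hc h2 h3
  obtain rfl : onLine v.1 = u := funext hv
  exact ⟨v, h1⟩

/-- `K` is the operator `(1 - ∂²)⁻¹` on even functions. -/
def IsResolvent (K : EvenFun L →L[ℝ] EvenFun L) : Prop :=
  ∀ f u : EvenFun L,
    K f = u ↔ HasSecondDeriv (onLine u.1) (fun x => onLine u.1 x - onLine f.1 x)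

variable {K : EvenFun L →L[ℝ] EvenFun L}

theorem IsResolvent.apply_cosMode (hK : IsResolvent K) :
    K (cosMode L) = (1 / (1 + (2 * Real.pi / L) ^ 2)) • cosMode L := by
  rw [hK]
  refine (hasSecondDeriv_cosMode.const_mul (1 / (1 + (2 * Real.pi / L) ^ 2))).congr'
    (fun x => (onLine_smul _ _ x).symm) fun x => ?_
  have : (1 + (2 * Real.pi / L) ^ 2) ≠ 0 := by positivity
  rw [onLine_smul]
  generalize 2 * Real.pi / L = k at *
  field_simp
  ring

theorem IsResolvent.cosCoeff_apply (hK : IsResolvent K) (f : EvenFun L) :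
    cosCoeff L (K f) = 1 / (1 + (2 * Real.pi / L) ^ 2) * cosCoeff L f := by
  have h : (1 + (2 * Real.pi / L) ^ 2) ≠ 0 := by positivity
  rw [← cosCoeff_of_resolvent ((hK f _).1 rfl), one_div, inv_mul_cancel_left₀ h]

theorem IsResolvent.exists_eq_smul_cosMode (hK : IsResolvent K) {w : EvenFun L}
    (hw : (1 / (1 + (2 * Real.pi / L) ^ 2)) • w - K w = 0) : ∃ a : ℝ, w = a • cosMode L := by
  refine ⟨_, eq_smul_cosMode ?_⟩
  have h : (1 + (2 * Real.pi / L) ^ 2) ≠ 0 := by positivity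
  have h1 := (hK _ _).1 (sub_eq_zero.1 hw).symm
  refine HasSecondDeriv.congr (u := onLine w.1) ?_ fun x => rfl
  have h2 := h1.const_mul (1 + (2 * Real.pi / L) ^ 2)
  simp only [onLine_smul] at h2
  convert h2 using 1
  · ext x; field_simp
  · ext x; generalize 2 * Real.pi / L = k at *; field_simp; ring

theorem IsResolvent.exists_sub_eq (hK : IsResolvent K) {y : EvenFun L}
    (hy : cosCoeff L y = 0) : ∃ w, (1 / (1 + (2 * Real.pi / L) ^ 2)) • w - K w = y := by
  have h : (1 + (2 * Real.pi / L) ^ 2) ≠ 0 := by positivity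
  obtain ⟨u, hu⟩ := exists_resonant_solution (f := (1 + (2 * Real.pi / L) ^ 2) • y)
    (by rw [map_smul, hy, smul_zero])
  -- The equation for `u` says precisely that `K` sends this vector to `u`.
  refine ⟨(1 + (2 * Real.pi / L) ^ 2) • (y + u), ?_⟩
  have hKu : K ((1 + (2 * Real.pi / L) ^ 2) • (y + u)) = u := by
    rw [hK]
    refine hu.congr fun x => ?_
    simp only [onLine_smul, onLine_add]
    ring
  rw [hKu, smul_smul, one_div, inv_mul_cancel₀ h, one_smul, add_sub_cancel_right]

end CosineMode

/-! ### The equation as an operator family applied to h -/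

section BifurcationOperator

variable {B : Type*} [NormedCommRing B] [NormedAlgebra ℝ B]

/-- The operator `v ↦ -Q v - K ((1 + Q (e₁ (-h Q) - 1)) v)` at `(c, h)`, with `Q = Q (c, h)`. -/
def bifurcationOperator (K : B →L[ℝ] B) (Q : ℝ × B → B) (e₁ : B → B) (q : ℝ × B) : B →L[ℝ] B :=
  -ContinuousLinearMap.mul ℝ B (Q q) -
    K.comp (ContinuousLinearMap.mul ℝ B (1 + Q q * (e₁ (-(q.2 * Q q)) - 1)))

theorem bifurcationOperator_apply (K : B →L[ℝ] B) (Q : ℝ × B → B) (e₁ : B → B) (q : ℝ × B)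
    (v : B) : bifurcationOperator K Q e₁ q v =
      -(Q q * v) - K ((1 + Q q * (e₁ (-(q.2 * Q q)) - 1)) * v) := rfl

theorem analyticAt_bifurcationOperator {K : B →L[ℝ] B} {Q : ℝ × B → B} {e₁ : B → B} {c : ℝ}
    (hQ : AnalyticAt ℝ Q (c, 0)) (he : AnalyticAt ℝ e₁ 0) :
    AnalyticAt ℝ (bifurcationOperator K Q e₁) (c, 0) := by
  have h1 : AnalyticAt ℝ (fun q : ℝ × B => e₁ (-(q.2 * Q q))) (c, 0) := by
    refine AnalyticAt.fun_comp (g := e₁) (f := fun q : ℝ × B => -(q.2 * Q q)) ?_ ?_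
    · simpa using he
    · exact (analyticAt_snd.mul hQ).neg
  have h2 : AnalyticAt ℝ (fun q : ℝ × B => 1 + Q q * (e₁ (-(q.2 * Q q)) - 1)) (c, 0) :=
    analyticAt_const.add (hQ.mul (h1.sub analyticAt_const))
  have h3 := AnalyticAt.fun_comp
    (g := ContinuousLinearMap.compL ℝ B B B K ∘L ContinuousLinearMap.mul ℝ B)
    (ContinuousLinearMap.analyticAt _ _) h2
  have h4 := AnalyticAt.fun_comp (g := ContinuousLinearMap.mul ℝ B)
    (ContinuousLinearMap.analyticAt _ _) hQ
  exact h4.neg.sub h3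

/-- With `φ = -(h * Q)` the right side is the fixed-point form `K (h - φ * (e₁ φ - 1)) = φ`; the
left side comes from factoring out `h`. -/
theorem bifurcationOperator_apply_self {K : B →L[ℝ] B} {Q : ℝ × B → B} {e₁ : B → B} (c : ℝ) (h : B) :
    bifurcationOperator K Q e₁ (c, h) h = 0 ↔
      K (h - -(h * Q (c, h)) * (e₁ (-(h * Q (c, h))) - 1)) = -(h * Q (c, h)) := by
  rw [bifurcationOperator_apply, sub_eq_zero, mul_comm (Q (c, h)) h, eq_comm]
  ring_nf

end BifurcationOperator

/-! ### Analytic difference quotients of the nonlinearities -/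

section Profile

theorem analyticAt_dslope {g : ℝ → ℝ} {a : ℝ} (hg : AnalyticAt ℝ g a) :
    AnalyticAt ℝ (dslope g a) a := by
  obtain ⟨P, hP⟩ := hg
  exact hP.has_fpower_series_dslope_fslope.analyticAt

/-- The quotient `(e^y - 1) / y`. -/
def expSlope : ℝ → ℝ := dslope Real.exp 0

theorem mul_expSlope (y : ℝ) : y * expSlope y = Real.exp y - 1 := by
  have := sub_smul_dslope Real.exp 0 y
  simpa [expSlope] using this

theorem expSlope_zero : expSlope 0 = 1 := by simp [expSlope]

theorem analyticAt_expSlope : AnalyticAt ℝ expSlope 0 := analyticAt_dslope analyticAt_rexp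

/-- The quotient `(p (1 + y) - p 1) / y`. -/
def profileSlope (p : ℝ → ℝ) (y : ℝ) : ℝ := dslope p 1 (1 + y)

theorem mul_profileSlope (p : ℝ → ℝ) (y : ℝ) : y * profileSlope p y = p (1 + y) - p 1 := by
  have := sub_smul_dslope p 1 (1 + y)
  simpa [profileSlope] using this

theorem profileSlope_zero (p : ℝ → ℝ) : profileSlope p 0 = deriv p 1 := by simp [profileSlope]

theorem analyticAt_profileSlope {p : ℝ → ℝ} (hp : AnalyticAt ℝ p 1) :
    AnalyticAt ℝ (profileSlope p) 0 := by
  refine AnalyticAt.fun_comp (g := dslope p 1) (f := fun y : ℝ => 1 + y) ?_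
    (analyticAt_const.add analyticAt_id)
  rw [add_zero]
  exact analyticAt_dslope hp

/-- The quotient `(1 / (1 + y)² - 1) / y`. -/
def inverseSquareSlope (y : ℝ) : ℝ := -(2 + y) / (1 + y) ^ 2

theorem mul_inverseSquareSlope {y : ℝ} (hy : 1 + y ≠ 0) :
    y * inverseSquareSlope y = 1 / (1 + y) ^ 2 - 1 := by
  unfold inverseSquareSlope
  field_simp
  ring

theorem analyticAt_inverseSquareSlope : AnalyticAt ℝ inverseSquareSlope 0 := by
  refine AnalyticAt.fun_div (analyticAt_const.add analyticAt_id).neg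
    ((analyticAt_const.add analyticAt_id).pow 2) ?_
  norm_num

theorem localG_eq (p : ℝ → ℝ) (c : ℝ) {y : ℝ} (hy : 1 + y ≠ 0) :
    localG p c (1 + y) = y * (c ^ 2 / 2 * inverseSquareSlope y + profileSlope p y) := by
  unfold localG
  linear_combination (-(c ^ 2 / 2)) * mul_inverseSquareSlope hy - mul_profileSlope p y

end Profile

/-! ### Solvability of 𝓗(φ) = 1 + h and zeros of 𝓕 -/

section Torus

variable {L : ℝ}

theorem evenFun_ext {f g : EvenFun L} (h : ∀ x, onLine f.1 x = onLine g.1 x) :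
    f = g := Subtype.ext (onLine_injective h)

theorem invH_eq_iff {f φ : C(AddCircle L, ℝ)} (hf : ∃! φ, SolvesH f φ) :
    invH f = φ ↔ SolvesH f φ := by
  have h : SolvesH f (invH f) := Classical.epsilon_spec hf.exists
  exact ⟨fun h' => h' ▸ h, fun h' => hf.unique h h'⟩

variable [hL : Fact (0 < L)]

/-- The operator on even functions given near `0` by superposition with an analytic germ. -/
theorem exists_superposition {g : ℝ → ℝ} (hg : AnalyticAt ℝ g 0) :
    ∃ G : EvenFun L → EvenFun L, AnalyticAt ℝ G 0 ∧
      ∀ᶠ h in 𝓝 (0 : EvenFun L), ∀ x, onLine (G h).1 x = g (onLine h.1 x) := by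
  obtain ⟨G, hG, h⟩ := exists_analyticAt_functionalCalculus (B := EvenFun L) hg
  exact ⟨G, hG, h.mono fun b hb x => hb (evalCharacter L x) fun f => by
    rw [evalCharacter_apply, evenFun_norm_def]; exact abs_onLine_le f.1 x⟩

variable {K : EvenFun L →L[ℝ] EvenFun L}

/-- Since `φ e₁(φ) = e^φ - 1`, the equation `-φ'' + e^φ = 1 + h` is `φ - φ'' = h - φ (e₁(φ) - 1)`.
-/
theorem IsResolvent.solvesH_iff (hK : IsResolvent K) {e₁ : EvenFun L → EvenFun L}
    {φ : EvenFun L} (he : ∀ x, onLine (e₁ φ).1 x = expSlope (onLine φ.1 x))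
    (h : EvenFun L) :
    K (h - φ * (e₁ φ - 1)) = φ ↔ SolvesH (1 + h).1 φ.1 := by
  rw [hK, EulerPoisson.solvesH_iff]
  refine iff_of_eq (congrArg _ (funext fun x => ?_))
  have h1 : onLine (h - φ * (e₁ φ - 1)).1 x =
      onLine h.1 x - onLine φ.1 x * (onLine (e₁ φ).1 x - 1) := by simp only [onLine_sub, onLine_mul, onLine_one]
  have h2 : onLine (1 + h).1 x = 1 + onLine h.1 x := by rw [onLine_add, onLine_one]
  rw [h1, h2, he]
  linear_combination mul_expSlope (onLine φ.1 x)

theorem superposition_zero {G : EvenFun L → EvenFun L} {g : ℝ → ℝ}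
    (h : ∀ᶠ h in 𝓝 (0 : EvenFun L), ∀ x, onLine (G h).1 x = g (onLine h.1 x)) :
    G 0 = g 0 • (1 : EvenFun L) :=
  evenFun_ext fun x => by rw [h.self_of_nhds x, onLine_zero, onLine_smul, onLine_one, mul_one]

/-- Existence comes from the inverse function theorem at `φ = 0`, and uniqueness from the maximum
principle. -/
theorem eventually_existsUnique_solvesH :
    ∀ᶠ h in 𝓝 (0 : EvenFun L), ∃! φ, SolvesH (1 + h).1 φ := by
  obtain ⟨K, hK⟩ : ∃ K, IsResolvent (L := L) K := exists_resolvent_clm L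
  obtain ⟨e₁, he, hev⟩ := exists_superposition (L := L) analyticAt_expSlope
  have he0 : e₁ 0 = 1 := by rw [superposition_zero hev, expSlope_zero, one_smul]
  -- The correction is quadratic at `0` because `e₁ 0 = 1`, so the derivative is the identity and
  -- the map covers a neighbourhood of `0`, hence `K h` for small `h`.
  have h1 : HasStrictFDerivAt (fun φ => φ + K (φ * (e₁ φ - 1)))
      ((ContinuousLinearEquiv.refl ℝ (EvenFun L) :
        EvenFun L →L[ℝ] EvenFun L)) 0 := by
    have h2 : HasStrictFDerivAt (fun φ : EvenFun L => φ) (ContinuousLinearMap.id ℝ _) 0 :=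
      hasStrictFDerivAt_id 0
    have h3 := h2.add (K.hasStrictFDerivAt.comp (0 : EvenFun L)
      (h2.mul (he.hasStrictFDerivAt.sub_const 1)))
    refine h3.congr_fderiv ?_
    ext1 v
    change v + K ((0 : EvenFun L) * fderiv ℝ e₁ 0 v + (e₁ 0 - 1) * v) = v
    rw [he0, sub_self, zero_mul, zero_mul, add_zero, map_zero, add_zero]
  have hmap := h1.map_nhds_eq_of_equiv
  simp only [zero_mul, map_zero, add_zero] at hmap
  have h4 : ∀ᶠ y in 𝓝 (0 : EvenFun L), ∃ φ, φ + K (φ * (e₁ φ - 1)) = y ∧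
      ∀ x, onLine (e₁ φ).1 x = expSlope (onLine φ.1 x) := by
    rw [← hmap, eventually_map]
    exact hev.mono fun φ hφ => ⟨φ, rfl, hφ⟩
  have h5 : Tendsto K (𝓝 0) (𝓝 0) := by simpa using K.continuous.tendsto 0
  filter_upwards [h5.eventually h4] with h hh
  obtain ⟨φ, h6, h7⟩ := hh
  have h8 : SolvesH (1 + h).1 φ.1 := by
    rw [← hK.solvesH_iff h7, map_sub, ← h6, add_sub_cancel_right]
  exact ⟨φ.1, h8, fun ψ hψ => solvesH_unique hψ h8⟩

/-- A zero of 𝓕 prescribes `𝓗⁻¹(f)` as `-𝓖_c(f)`, so only one explicit candidate has to be tested in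
the differential equation. -/
theorem functionalF_eq_zero_iff {p : ℝ → ℝ} {c : ℝ} {h φ : EvenFun L}
    (hd : ∃! φ, SolvesH (1 + h).1 φ) (hφ : ∀ x, onLine φ.1 x = -localG p c (1 + onLine h.1 x)) :
    functionalF p c (evenEquiv L (1 + h)) = 0 ↔ SolvesH (1 + h).1 φ.1 := by
  rw [← invH_eq_iff hd]
  have hval : ∀ x : ℝ, functionalF p c (evenEquiv L (1 + h)) (x : AddCircle L) =
      localG p c (1 + onLine h.1 x) + onLine (invH (1 + h).1) x := fun x => by
    rw [← onLine_one (L := L) x, ← onLine_add, ← evenEquiv_coe]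
    rfl
  constructor
  · intro h0
    refine onLine_injective fun x => ?_
    have := congrFun h0 (x : AddCircle L)
    rw [hval, Pi.zero_apply] at this
    rw [hφ]
    linarith
  · intro h0
    ext x
    induction x using QuotientAddGroup.induction_on with
    | H x =>
      refine (hval x).trans ?_
      rw [h0, hφ]
      simp

end Torus

/-! ### Assembly of the operator family and the bifurcation theorem -/

section Main

theorem analyticAt_of_linear {E F : Type*} [NormedAddCommGroup E] [NormedSpace ℝ E]
    [NormedAddCommGroup F] [NormedSpace ℝ F] {f : E → F} (hadd : ∀ x y, f (x + y) = f x + f y)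
    (hsmul : ∀ (a : ℝ) x, f (a • x) = a • f x) (hnorm : ∀ x, ‖f x‖ ≤ ‖x‖) (x : E) :
    AnalyticAt ℝ f x :=
  (LinearMap.mkContinuous ⟨⟨f, hadd⟩, hsmul⟩ 1 fun x => by
    rw [one_mul]; exact hnorm x).analyticAt x

variable {L : ℝ}

theorem bifurcationSpeed_sq {p : ℝ → ℝ} (hp : 0 < deriv p 1) :
    bifurcationSpeed p L ^ 2 = deriv p 1 + 1 / (1 + (2 * Real.pi / L) ^ 2) :=
  Real.sq_sqrt (by positivity)

theorem bifurcationSpeed_pos {p : ℝ → ℝ} (hp : 0 < deriv p 1) : 0 < bifurcationSpeed p L :=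
  Real.sqrt_pos.2 (by positivity)

variable [hL : Fact (0 < L)]

theorem analyticAt_evenEquiv (f : EvenFun L) : AnalyticAt ℝ (evenEquiv L) f :=
  analyticAt_of_linear evenFunEquiv_add evenFunEquiv_smul (fun f => (evenFun_norm_def f).ge) f

/-- The functional factors, near the trivial solution, through an analytic family of operators. -/
theorem exists_operator_family {p : ℝ → ℝ} (hp : AnalyticAt ℝ p 1) (c₀ : ℝ) :
    ∃ (K : EvenFun L →L[ℝ] EvenFun L) (A : ℝ × EvenFun L → EvenFun L →L[ℝ] EvenFun L),
      IsResolvent K ∧ AnalyticAt ℝ A (c₀, 0) ∧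
      (∀ c v, A (c, 0) v = (c ^ 2 - deriv p 1) • v - K v) ∧
      ∀ᶠ q in 𝓝 (c₀, (0 : EvenFun L)),
        (q.1, evenEquiv L (1 + q.2)) ∈ domainF L ∧
        (functionalF p q.1 (evenEquiv L (1 + q.2)) = 0 ↔ A q q.2 = 0) := by
  obtain ⟨K, hK⟩ : ∃ K, IsResolvent (L := L) K := exists_resolvent_clm L
  obtain ⟨e₁, he, hev⟩ := exists_superposition (L := L) analyticAt_expSlope
  obtain ⟨G, hG, hGv⟩ := exists_superposition (L := L) analyticAt_inverseSquareSlope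
  obtain ⟨P, hP, hPv⟩ := exists_superposition (L := L) (analyticAt_profileSlope hp)
  have he0 : e₁ 0 = 1 := by rw [superposition_zero hev, expSlope_zero, one_smul]
  -- `Q` is the quotient of `𝓖_c(1 + h)` by `h`; dividing on the level of scalar germs keeps it
  -- analytic at `h = 0`.
  set Q : ℝ × EvenFun L → EvenFun L := fun q => (q.1 ^ 2 / 2) • G q.2 + P q.2 with hQdef
  have hQ : AnalyticAt ℝ Q (c₀, 0) := by
    have h1 : AnalyticAt ℝ (fun q : ℝ × EvenFun L => G q.2) (c₀, 0) :=
      AnalyticAt.fun_comp hG analyticAt_snd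
    have h2 : AnalyticAt ℝ (fun q : ℝ × EvenFun L => P q.2) (c₀, 0) :=
      AnalyticAt.fun_comp hP analyticAt_snd
    have h3 : AnalyticAt ℝ (fun q : ℝ × EvenFun L => q.1 ^ 2 / 2) (c₀, 0) :=
      (analyticAt_fst.pow 2).fun_div analyticAt_const two_ne_zero
    exact (h3.smul h1).add h2
  have hQ0 : ∀ c, Q (c, 0) = (deriv p 1 - c ^ 2) • (1 : EvenFun L) := by
    intro c
    simp only [hQdef]
    rw [superposition_zero hGv, superposition_zero hPv, profileSlope_zero, smul_smul, ← add_smul]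
    congr 1
    norm_num [inverseSquareSlope]
    ring
  refine ⟨K, bifurcationOperator K Q e₁, hK, analyticAt_bifurcationOperator hQ he, fun c v => ?_, ?_⟩
  · rw [bifurcationOperator_apply, zero_mul, neg_zero, he0, sub_self, mul_zero, add_zero, one_mul,
      hQ0, smul_mul_assoc, one_mul, ← neg_smul, neg_sub]
  · have hsnd : Tendsto (fun q : ℝ × EvenFun L => q.2) (𝓝 (c₀, 0)) (𝓝 0) := continuousAt_snd
    have hφ : Tendsto (fun q : ℝ × EvenFun L => -(q.2 * Q q)) (𝓝 (c₀, 0)) (𝓝 0) := by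
      have : ContinuousAt (fun q : ℝ × EvenFun L => -(q.2 * Q q)) (c₀, 0) :=
        (continuousAt_snd.mul hQ.continuousAt).neg
      simpa [ContinuousAt] using this
    have hnorm : ∀ᶠ h in 𝓝 (0 : EvenFun L), ‖h‖ < 1 :=
      (continuous_norm.tendsto' (0 : EvenFun L) 0 norm_zero).eventually_lt_const one_pos
    filter_upwards [hsnd.eventually hGv, hsnd.eventually hPv, hφ.eventually hev,
      hsnd.eventually eventually_existsUnique_solvesH, hsnd.eventually hnorm] with q h1 h2 h3 h4 h5
    obtain ⟨c, h⟩ := q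
    simp only at h1 h2 h3 h4 h5
    have hpos : ∀ x, 0 < 1 + onLine h.1 x := fun x => by
      have := (abs_lt.1 ((abs_onLine_le h.1 x).trans_lt ((evenFun_norm_def h).symm.trans_lt h5))).1
      linarith
    have hval : ∀ x : ℝ, (evenEquiv L (1 + h)).1 (x : AddCircle L) = 1 + onLine h.1 x := fun x => by
      rw [evenEquiv_coe, ← onLine_one (L := L) x, ← onLine_add]
      rfl
    refine ⟨⟨fun x => ?_, by rwa [evenEquiv_coe]⟩, ?_⟩
    · induction x using QuotientAddGroup.induction_on with
      | H x => exact (hpos x).trans_eq (hval x).symm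
    · rw [bifurcationOperator_apply_self, hK.solvesH_iff h3]
      refine functionalF_eq_zero_iff h4 fun x => ?_
      rw [localG_eq p c (hpos x).ne', ← h1, ← h2]
      have h6 : onLine (-(h * Q (c, h))).1 x = -onLine (h * Q (c, h)).1 x := by
        rw [← zero_sub, onLine_sub, onLine_zero, zero_sub]
      rw [h6, onLine_mul, hQdef, onLine_add, onLine_smul]

end Main

end EulerPoisson

end

theorem theorem4p1 (p : ℝ → ℝ) (hp : EulerPoisson.IsAdmissibleProfile p)
    (L : ℝ) [Fact (0 < L)] :
    ∃ ε : ℝ, 0 < ε ∧ ∃ (Ψ : ℝ → ℝ) (Φ : ℝ → EulerPoisson.CEven L),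
      AnalyticOnNhd ℝ Ψ (Set.Ioo (-ε) ε) ∧
      AnalyticOnNhd ℝ Φ (Set.Ioo (-ε) ε) ∧
      Ψ 0 = EulerPoisson.bifurcationSpeed p L ∧
      Φ 0 = EulerPoisson.evenOne L ∧
      (∀ s ∈ Set.Ioo (-ε) ε, EulerPoisson.functionalF p (Ψ s) (Φ s) = 0) ∧
      (∃ U₀ : Set (ℝ × EulerPoisson.CEven L), IsOpen U₀ ∧
        (EulerPoisson.bifurcationSpeed p L, EulerPoisson.evenOne L) ∈ U₀ ∧
        U₀ ⊆ EulerPoisson.domainF L ∧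
        {q : ℝ × EulerPoisson.CEven L | q ∈ U₀ ∧
            EulerPoisson.functionalF p q.1 q.2 = 0 ∧ q.2 ≠ EulerPoisson.evenOne L} =
          {q : ℝ × EulerPoisson.CEven L | ∃ s : ℝ, 0 < |s| ∧ |s| < ε ∧ q = (Ψ s, Φ s)}) ∧
      (∃ C : ℝ, ∀ s ∈ Set.Ioo (-ε) ε,
        ‖Φ s - (EulerPoisson.evenOne L + s • EulerPoisson.evenCos L)‖ ≤ C * s ^ 2) ∧
      (∃ C : ℝ, ∀ s ∈ Set.Ioo (-ε) ε,
        |Ψ s - (EulerPoisson.bifurcationSpeed p L + deriv Ψ 0 * s +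
          1 / 2 * iteratedDeriv 2 Ψ 0 * s ^ 2)| ≤ C * |s| ^ 3) := by
  open EulerPoisson in
  have hp1 : 0 < deriv p 1 := hp.deriv_pos 1 one_pos
  have hc := bifurcationSpeed_pos (L := L) hp1
  have hc2 := bifurcationSpeed_sq (L := L) hp1
  obtain ⟨K, A, hK, hA, hA0, hN⟩ := exists_operator_family (L := L)
    (hp.analytic 1 (mem_Ioi.2 one_pos)) (bifurcationSpeed p L)
  set c₀ := bifurcationSpeed p L with hc₀
  have hA₀ : ∀ w, A (c₀, 0) w = (1 / (1 + (2 * Real.pi / L) ^ 2)) • w - K w := fun w => by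
    rw [hA0, hc2, add_sub_cancel_left]
  obtain ⟨Ψ, V, hΨ, hV, hΨ0, hV0, hε⟩ := exists_bifurcation_curve hA
    (l := cosCoeff L) (e := cosMode L) (μ := 2 * c₀) cosCoeff_cosMode (by positivity)
    (by rw [hA₀, hK.apply_cosMode, sub_self])
    (by
      -- Transversality: only the scalar part of `A (c, 0)` depends on `c`.
      have h1 : HasDerivAt (fun c : ℝ => c ^ 2 - deriv p 1) (2 * c₀) c₀ := by
        simpa using (hasDerivAt_pow 2 c₀).sub_const (deriv p 1)
      have h2 := (h1.smul_const (cosMode L)).sub_const (K (cosMode L))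
      exact h2.congr_of_eventuallyEq (Eventually.of_forall fun c => hA0 c _))
    (fun w => by rw [hA₀, map_sub, map_smul, hK.cosCoeff_apply, smul_eq_mul, sub_self])
    (fun w hw => hK.exists_eq_smul_cosMode (by rwa [hA₀] at hw))
    (fun y hy => by simpa only [hA₀] using hK.exists_sub_eq hy) hN
  obtain ⟨C₁, hC₁⟩ := exists_norm_sub_le_of_analyticAt hV
  obtain ⟨C₂, hC₂⟩ := exists_taylor_two_bound hΨ
  obtain ⟨ε₀, hε₀, hloc⟩ := Metric.eventually_nhds_iff.1
    ((hΨ.eventually_analyticAt.and hV.eventually_analyticAt).and (hC₁.and hC₂))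
  -- The curve is available for all small `ε`, so `ε` can also be taken below the radius on which
  -- analyticity and both Taylor bounds hold.
  obtain ⟨ε, ⟨hcurve, U, hU, hUm, hUN, hUeq⟩, hε1, hε2⟩ :=
    (hε.and (Ioo_mem_nhdsGT hε₀)).exists
  have hloc' : ∀ s ∈ Ioo (-ε) ε, |s| < ε ∧ (AnalyticAt ℝ Ψ s ∧ AnalyticAt ℝ V s) ∧
      ‖V s - V 0‖ ≤ C₁ * |s| ∧
      |Ψ s - (Ψ 0 + deriv Ψ 0 * s + 1 / 2 * iteratedDeriv 2 Ψ 0 * s ^ 2)| ≤ C₂ * |s| ^ 3 := by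
    intro s hs
    have hs' := abs_lt.2 hs
    refine ⟨hs', hloc ?_⟩
    rw [Real.dist_eq, sub_zero]
    exact hs'.trans hε2
  have hone := evenEquiv_one (L := L)
  have hmemU : ∀ s, |s| < ε → (Ψ s, s • V s) ∈ U := by
    intro s hs
    rcases eq_or_ne s 0 with rfl | hs0
    · rw [zero_smul, hΨ0]; exact hUm
    · have : (Ψ s, s • V s) ∈ {q : ℝ × EvenFun L | q ∈ U ∧ A q q.2 = 0 ∧ q.2 ≠ 0} := by
        rw [hUeq]; exact ⟨s, abs_pos.2 hs0, hs, rfl⟩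
      exact this.1
  have hround : ∀ f : CEven L, evenEquiv L (1 + (evenEquiv L).symm (f - evenOne L)) = f := by
    intro f
    rw [LinearIsometryEquiv.map_add, hone, LinearIsometryEquiv.apply_symm_apply, add_sub_cancel]
  refine ⟨ε, hε1, Ψ, fun s => evenEquiv L (1 + s • V s), fun s hs => (hloc' s hs).2.1.1,
    fun s hs => ?_, hΨ0, ?_, fun s hs => ?_,
    ⟨{q | (q.1, (evenEquiv L).symm (q.2 - evenOne L)) ∈ U}, ?_, ?_, fun q hq => ?_, ?_⟩,
    ⟨C₁, fun s hs => ?_⟩, ⟨C₂, fun s hs => ?_⟩⟩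
  · have h1 : AnalyticAt ℝ (fun s => 1 + s • V s) s :=
      analyticAt_const.add (analyticAt_id.smul (hloc' s hs).2.1.2)
    exact AnalyticAt.fun_comp (analyticAt_evenEquiv _) h1
  · change evenEquiv L (1 + (0 : ℝ) • V 0) = _
    rw [zero_smul, add_zero, hone]
  · have hs' := (hloc' s hs).1
    exact (hUN (hmemU s hs')).2.2 (hcurve s hs')
  · refine hU.preimage (continuous_fst.prodMk ?_)
    exact (evenEquiv L).symm.continuous.comp (continuous_snd.sub continuous_const)
  · change (c₀, (evenEquiv L).symm (evenOne L - evenOne L)) ∈ U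
    rw [sub_self, LinearIsometryEquiv.map_zero]
    exact hUm
  · have := (hUN hq).1
    rwa [hround] at this
  · ext ⟨c, f⟩
    have key := Set.ext_iff.1 hUeq (c, (evenEquiv L).symm (f - evenOne L))
    simp only [mem_ofPred_eq, Prod.mk.injEq] at key ⊢
    have h1 : (c, (evenEquiv L).symm (f - evenOne L)) ∈ U →
        (functionalF p c f = 0 ↔ A (c, (evenEquiv L).symm (f - evenOne L))
          ((evenEquiv L).symm (f - evenOne L)) = 0) := by
      intro h
      have := (hUN h).2
      rwa [hround] at this
    have h2 : f ≠ evenOne L ↔ (evenEquiv L).symm (f - evenOne L) ≠ 0 := by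
      rw [ne_eq, ne_eq, LinearIsometryEquiv.map_eq_zero_iff, sub_eq_zero]
    have h3 : ∀ s, f = evenEquiv L (1 + s • V s) ↔
        (evenEquiv L).symm (f - evenOne L) = s • V s := by
      intro s
      rw [LinearIsometryEquiv.symm_apply_eq, LinearIsometryEquiv.map_add, hone, sub_eq_iff_eq_add']
    simp only [h3]
    rw [← key, h2]
    exact and_congr_right fun h => and_congr_left fun _ => h1 h
  · have h1 : evenEquiv L (1 + s • V s) - (evenOne L + s • evenCos L) =
        evenEquiv L (s • (V s - V 0)) := by
      have : evenCos L = evenEquiv L (V 0) := by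
        rw [hV0]; exact Subtype.ext (evenEquiv_coe _).symm
      rw [this, LinearIsometryEquiv.map_add, hone, smul_sub, LinearIsometryEquiv.map_sub,
        LinearIsometryEquiv.map_smul, LinearIsometryEquiv.map_smul]
      abel
    change ‖evenEquiv L (1 + s • V s) - (evenOne L + s • evenCos L)‖ ≤ _
    rw [h1, LinearIsometryEquiv.norm_map, norm_smul, Real.norm_eq_abs, ← sq_abs]
    calc |s| * ‖V s - V 0‖ ≤ |s| * (C₁ * |s|) := by gcongr; exact (hloc' s hs).2.2.1
      _ = C₁ * |s| ^ 2 := by ring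
  · have := (hloc' s hs).2.2.2
    rwa [hΨ0] at this
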